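/- **Setting.** A hypergraph is finite, may have parallel hyperedges, and carries positive hyperedge weights; the rank $|e|$ of a hyperedge is its number of vertices, $\partial X$ is the set of hyperedges with vertices both inside and outside $X$, and $\mathcal C(X)$ is the total weight of $\partial X$. Let $G=(V,E)$ be a hypergraph and $T\subseteq V$ a set of terminals. A *$T$-Steiner cut* is an $X\subseteq V$ with $T\cap X\ne\emptyset\ne T\setminus X$; a *$T$-Steiner mincut* is one of minimum value, and this value is $\lambda_G(T)$. For $\emptyset\ne A\subsetneq T$, an *$A$-cut of $T$* is a set $X\supseteq A$ disjoint from $T\setminus A$ such that after deleting $\partial X$ every vertex of $X$ is still connected to a vertex of $A$; an *$A$-mincut of $T$* is an $A$-cut of minimum value; it is *maximal* if it contains every $A$-mincut of $T$; a (maximal) *$t$-isolating mincut of $T$* is a (maximal) $\{t\}$-mincut of $T$. A *hypercactus* is a connected hypergraph $H$, all of whose hyperedges have rank at least $2$, such that every rank-2 edge lies in at most one cycle, this cycle contains only rank-2 edges, and removing a hyperedge of rank $r>2$ leaves exactly $r$ connected components, each of which is again a hypercactus. A *global mincut* of $H$ is a nonempty proper subset $Q\subsetneq V(H)$ of minimum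 value, and $Q$ *separates* $A$ and $B$ if $A\subseteq Q$ and $B\cap Q=\emptyset$. A *$T$-Steiner hypercactus* $(H,\phi)$ of $G$ is a hypercactus $H$ with a map $\phi:T\to V(H)$ such that edges in cycles have weight $\lambda_G(T)/2$, all other hyperedges have weight $\lambda_G(T)$, and for every $\emptyset\neq A\subsetneq T$ an $A$-mincut of $T$ is a $T$-Steiner mincut if and only if some global mincut of $H$ separates $\phi(A)$ and $\phi(T\setminus A)$. A global mincut $Q$ of $H$ *corresponds* to $X\subseteq V$ if it separates $\phi(X\cap T)$ and $\phi(T\setminus X)$. A hyperedge $e$ of $H$ has *nonempty branches* if every connected component of $H-e$ contains $\phi(t)$ for some $t\in T$. **The algorithm.** A call on $(G,T)$ with $|T|\le 3$ ends without looking for splits. Otherwise it samples finitely many random subsets $T'\subseteq T$ and lets $\mathcal S_0$ be the set of all maximal $t$-isolating mincuts $X$ of the sampled sets $T'$ $(t\in T')$ with $\mathcal C(X)=\lambda_G(T)$. If some $X\in\mathcal S_0$ is balanced, meaning $|T\cap X|,|T\setminus X|\ge\frac14|T|$, it selects $\mathcal S=\{X\}$ for one such $X$. Otherwise it lists the inclusionwise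 maximal members of $\{X\in\mathcal S_0: 2\le|X\cap T|\le\frac14|T|\}$ as $X_1,\dots,X_k$ and selects $\mathcal S=\{X_i\setminus\bigcup_{j<i}X_j : i\le k\}$. If $\mathcal S\neq\emptyset$, it calls itself on the parts of the decomposition induced by $\mathcal S$: for each $X\in\mathcal S$ the hypergraph with $V\setminus X$ contracted to one vertex, and one last hypergraph in which each $X\in\mathcal S$ is contracted to one vertex; the contracted vertices become terminals. Accordingly, a family $\mathcal Q$ of cuts of $H$ *decomposes a hyperedge $e$ of $H$ nontrivially* if, among the hypergraphs obtained from $H$ by contracting $V(H)\setminus Q$ (one for each $Q\in\mathcal Q$) and the one obtained by contracting each $Q\in\mathcal Q$ to one vertex, at least two contain an image of $e$ of rank at least $3$. **Lemma.** 1. Let $(H,\phi)$ be any $T$-Steiner hypercactus of $G$ and $e$ a hyperedge of $H$ of rank at least $3$ with nonempty branches. Let $T'\subseteq T$, $|T'|\ge2$, $t\in T'$, and suppose that the maximal $t$-isolating mincut $X$ of $T'$ is a $T'$-Steiner mincut. Then every global mincut $Q$ of $H$ corresponding to $X$ contains $0$, $1$, $|e|-1$ or $|e|$ of the nodes of $e$.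 2. Consequently the algorithm never splits high-rank hyperedges nontrivially. For every outcome of the random choices, every (recursive) call, on $(G',T')$ say, of the algorithm started on $(G,T)$, every $T'$-Steiner hypercactus $(H,\phi)$ of $G'$ and every hyperedge $e$ of $H$ of rank at least $3$ with nonempty branches: if $\mathcal S_0$ and $\mathcal S$ are the families found and selected in this call, then (a) for every $X\in\mathcal S_0\cup\mathcal S$ and every $Q$ corresponding to $X$, the single cut $Q$ does not decompose $e$ nontrivially; and (b) for any choice of a $Q_X$ corresponding to $X$ for each $X\in\mathcal S$, the family $\{Q_X:X\in\mathcal S\}$ does not decompose $e$ nontrivially. 3. Suppose that $|T|\ge4$ and $G$ has a $T$-Steiner hypercactus $(H,\phi)$ such that $H$ is a brittle (a single hyperedge containing all nodes) and $\phi$ is injective. Then there is a unique set $E'\subseteq E$ such that $\partial X_A=E'$ for the maximal $A$-mincut $X_A$ of $T$, for every nonempty $A\subseteq T$ with $|A|\le|T|-2$. -/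

import Mathlib

universe u v w x

/-- A hypergraph with positively weighted hyperedges. Hyperedges are indexed by `E`, so parallel
hyperedges are allowed; `inc e` is the set of vertices of the hyperedge `e`. -/
structure WHypergraph (V : Type u) (E : Type v) where
  inc : E → Set V
  weight : E → ℝ
  weight_pos : ∀ e, 0 < weight e

namespace WHypergraph

section Basic

variable {V : Type u} {E : Type v}

/-- The rank of a hyperedge: its number of vertices. -/
noncomputable def rank (G : WHypergraph V E) (e : E) : ℕ := (G.inc e).ncard

/-- The boundary `∂X`: the hyperedges with a vertex inside `X` and a vertex outside `X`. -/
def boundary (G : WHypergraph V E) (X : Set V) : Set E :=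
  {e | (G.inc e ∩ X).Nonempty ∧ (G.inc e \ X).Nonempty}

/-- The value `𝒞(X)` of the cut `(X, V \ X)`. -/
noncomputable def cutValue (G : WHypergraph V E) (X : Set V) : ℝ :=
  ∑ᶠ e ∈ G.boundary X, G.weight e

/-- There is a path from `a` to `b` that uses only hyperedges of `D`. -/
def Reach (G : WHypergraph V E) (D : Set E) (a b : V) : Prop :=
  Relation.ReflTransGen (fun y z => ∃ e ∈ D, y ∈ G.inc e ∧ z ∈ G.inc e) a b

/-- The vertex sets of the connected components of the hypergraph with vertex set `U` and
hyperedge set `D`. -/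
def components (G : WHypergraph V E) (U : Set V) (D : Set E) : Set (Set V) :=
  {C | ∃ y ∈ U, C = {z | z ∈ U ∧ G.Reach D y z}}

/-- `Q` is a global mincut. -/
def IsGlobalMincut (G : WHypergraph V E) (Q : Set V) : Prop :=
  Q.Nonempty ∧ Q ≠ Set.univ ∧
    ∀ R : Set V, R.Nonempty → R ≠ Set.univ → G.cutValue Q ≤ G.cutValue R

/-- `C` is the edge set of a cycle: for some `n = k + 2 ≥ 2` there are distinct vertices
`p 0, …, p (n-1)` and distinct hyperedges `f 0, …, f (n-1)`, the members of `C`, such that `f i`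
contains `p i` and `p (i+1)`, indices taken modulo `n`. -/
def IsCycle (G : WHypergraph V E) (C : Set E) : Prop :=
  ∃ (k : ℕ) (p : Fin (k + 2) → V) (f : Fin (k + 2) → E),
    Function.Injective p ∧ Function.Injective f ∧ Set.range f = C ∧
      ∀ i, p i ∈ G.inc (f i) ∧ p (i + 1) ∈ G.inc (f i)

/-! ### Steiner cuts and `A`-cuts -/

/-- `X` is a `T`-Steiner cut: it separates `T`. -/
def IsSteinerCut (T X : Set V) : Prop :=
  (T ∩ X).Nonempty ∧ (T \ X).Nonempty

/-- `X` is a `T`-Steiner mincut. -/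
def IsSteinerMincut (G : WHypergraph V E) (T X : Set V) : Prop :=
  IsSteinerCut T X ∧ ∀ Y, IsSteinerCut T Y → G.cutValue X ≤ G.cutValue Y

/-- `λ_G(T)`, the value of a `T`-Steiner mincut. -/
noncomputable def steinerValue (G : WHypergraph V E) (T : Set V) : ℝ :=
  sInf (G.cutValue '' {X | IsSteinerCut T X})

/-- `X` is an `A`-cut of `T`: `A` is a nonempty proper subset of `T`, the cut `X` separates `A`
from `T \ A` with `A ⊆ X`, and after removing the boundary `∂X` every vertex of `X` is still
connected to some vertex of `A`. -/
def IsCutOf (G : WHypergraph V E) (T A X : Set V) : Prop :=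
  A.Nonempty ∧ A ⊂ T ∧ A ⊆ X ∧ Disjoint (T \ A) X ∧
    ∀ y ∈ X, ∃ a ∈ A, G.Reach (G.boundary X)ᶜ y a

/-- `X` is an `A`-mincut of `T`. -/
def IsMincutOf (G : WHypergraph V E) (T A X : Set V) : Prop :=
  G.IsCutOf T A X ∧ ∀ Y, G.IsCutOf T A Y → G.cutValue X ≤ G.cutValue Y

/-- `X` is the maximal `A`-mincut of `T`. -/
def IsMaxMincutOf (G : WHypergraph V E) (T A X : Set V) : Prop :=
  G.IsMincutOf T A X ∧ ∀ Y, G.IsMincutOf T A Y → Y ⊆ X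

/-- `X` is the maximal `t`-isolating mincut of `T`. -/
def IsMaxIsolatingMincut (G : WHypergraph V E) (T : Set V) (t : V) (X : Set V) : Prop :=
  G.IsMaxMincutOf T {t} X

/-! ### Hypercacti -/

/-- The hypergraph with vertex set `U` and hyperedge set `D` (a part of `H`) is a hypercactus. -/
inductive IsHypercactusOn (H : WHypergraph V E) : Set V → Set E → Prop
  | intro (U : Set V) (D : Set E)
      (nonempty : U.Nonempty)
      (inside : ∀ e ∈ D, H.inc e ⊆ U)
      (two_le_rank : ∀ e ∈ D, 2 ≤ H.rank e)
      (connected : ∀ y ∈ U, ∀ z ∈ U, H.Reach D y z)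
      (cycle_rank : ∀ e ∈ D, H.rank e = 2 → ∀ C ⊆ D, H.IsCycle C → e ∈ C →
        ∀ f ∈ C, H.rank f = 2)
      (cycle_unique : ∀ e ∈ D, H.rank e = 2 → ∀ C ⊆ D, ∀ C' ⊆ D, H.IsCycle C → H.IsCycle C' →
        e ∈ C → e ∈ C' → C = C')
      (ncard_components : ∀ e ∈ D, 2 < H.rank e →
        (H.components U (D \ {e})).ncard = H.rank e)
      (component : ∀ e ∈ D, 2 < H.rank e → ∀ C ∈ H.components U (D \ {e}),
        IsHypercactusOn H C {f | f ∈ D \ {e} ∧ H.inc f ⊆ C}) :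
      IsHypercactusOn H U D

/-- `H` is a hypercactus. -/
def IsHypercactus (H : WHypergraph V E) : Prop := H.IsHypercactusOn Set.univ Set.univ

/-- `H` is a brittle: it has a single hyperedge, which contains all vertices. -/
def IsBrittle (H : WHypergraph V E) : Prop :=
  ∃ e, H.inc e = Set.univ ∧ ∀ f, f = e

end Basic

section Hypercactus

variable {V : Type u} {E : Type v} {W : Type w} {F : Type x}

/-- The cut `Q` separates `A` (inside `Q`) from `B` (outside `Q`). -/
def Separates (Q A B : Set W) : Prop := A ⊆ Q ∧ Disjoint B Q

/-- `(H, φ)` is a `T`-Steiner hypercactus of `G`. Only the values of `φ` on `T` matter. -/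
structure IsSteinerHypercactus (G : WHypergraph V E) (T : Set V) (H : WHypergraph W F)
    (φ : V → W) : Prop where
  isHypercactus : H.IsHypercactus
  weight_cycle : ∀ e, (∃ C, H.IsCycle C ∧ e ∈ C) → H.weight e = G.steinerValue T / 2
  weight_noncycle : ∀ e, (¬ ∃ C, H.IsCycle C ∧ e ∈ C) → H.weight e = G.steinerValue T
  mincut_iff : ∀ A X, G.IsMincutOf T A X →
    (G.IsSteinerMincut T X ↔ ∃ Q, H.IsGlobalMincut Q ∧ Separates Q (φ '' A) (φ '' (T \ A)))

/-- `Q` is a mincut of `H` corresponding to the cut `X`: a global mincut that separates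
`φ(X ∩ T)` from `φ(T \ X)`. -/
def Corresponds (T : Set V) (H : WHypergraph W F) (φ : V → W) (X : Set V) (Q : Set W) : Prop :=
  H.IsGlobalMincut Q ∧ Separates Q (φ '' (X ∩ T)) (φ '' (T \ X))

/-- Every connected component of `H - e` contains a nonempty node, that is, a node `φ t` with
`t ∈ T`. (As `H` is connected, each component of `H - e` contains a node of `e`.) -/
def NonemptyBranches (T : Set V) (H : WHypergraph W F) (φ : V → W) (e : F) : Prop :=
  ∀ y ∈ H.inc e, ∃ t ∈ T, H.Reach {e}ᶜ y (φ t)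

end Hypercactus

/-! ### Contraction and decomposition -/

section Contract

variable {V : Type u} {E : Type v}

/-- The vertex set after contracting each member of the family `𝒞` to a single vertex. -/
abbrev Contracted (𝒞 : Set (Set V)) : Type u :=
  Quot (fun y z : V => ∃ S ∈ 𝒞, y ∈ S ∧ z ∈ S)

/-- The contraction map. -/
def toContracted (𝒞 : Set (Set V)) (y : V) : Contracted 𝒞 := Quot.mk _ y

/-- Contract each member of `𝒞` to a single vertex and remove the hyperedges that shrink to one
vertex. Parallel hyperedges are kept, which changes no cut value. -/
def contract (G : WHypergraph V E) (𝒞 : Set (Set V)) :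
    WHypergraph (Contracted 𝒞) {e : E // (toContracted 𝒞 '' G.inc e).Nontrivial} where
  inc e := toContracted 𝒞 '' G.inc e.1
  weight e := G.weight e.1
  weight_pos e := G.weight_pos e.1

/-- The number of vertices of the hyperedge `e` after contracting each member of `𝒞`. -/
noncomputable def contractedRank (G : WHypergraph V E) (𝒞 : Set (Set V)) (e : E) : ℕ :=
  (toContracted 𝒞 '' G.inc e).ncard

/-- A family `𝒬` of cuts decomposes a hypergraph into one part for each `Q ∈ 𝒬`, in which the
complement of `Q` is contracted, and one last part, in which each `Q ∈ 𝒬` is contracted. This is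
the rank of what is left of the hyperedge `e` in the given part. -/
noncomputable def partRank (H : WHypergraph V E) (𝒬 : Set (Set V)) (e : E) : Option ↥𝒬 → ℕ
  | some Q => H.contractedRank {(Q : Set V)ᶜ} e
  | none => H.contractedRank 𝒬 e

/-- The hyperedge `e` is decomposed nontrivially by `𝒬`: hyperedges of rank at least `3` are left
of it in at least two parts. -/
def Decomposes (H : WHypergraph V E) (𝒬 : Set (Set V)) (e : E) : Prop :=
  ∃ i j : Option ↥𝒬, i ≠ j ∧ 3 ≤ H.partRank 𝒬 e i ∧ 3 ≤ H.partRank 𝒬 e j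

/-! ### The divide and conquer algorithm -/

/-- The cuts found by the sampling loop when the sampled terminal sets are the members of `𝒯`:
the maximal `t`-isolating mincuts of the sampled sets that have value `λ_G(T)`. -/
def foundCuts (G : WHypergraph V E) (T : Set V) (𝒯 : Set (Set V)) : Set (Set V) :=
  {X | ∃ T' ∈ 𝒯, ∃ t ∈ T', G.IsMaxIsolatingMincut T' t X ∧ G.cutValue X = G.steinerValue T}

/-- Both sides of `X` contain at least a quarter of the terminals. -/
def IsBalanced (T X : Set V) : Prop :=
  T.ncard ≤ 4 * (T ∩ X).ncard ∧ T.ncard ≤ 4 * (T \ X).ncard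

/-- The found cuts with at least two and at most a quarter of the terminals. -/
def smallCuts (T : Set V) (𝒮₀ : Set (Set V)) : Set (Set V) :=
  {X | X ∈ 𝒮₀ ∧ 2 ≤ (T ∩ X).ncard ∧ 4 * (T ∩ X).ncard ≤ T.ncard}

/-- The inclusionwise maximal members of a family. -/
def maximalMembers (𝒮 : Set (Set V)) : Set (Set V) :=
  {X | X ∈ 𝒮 ∧ ∀ Y ∈ 𝒮, Y ≠ X → ¬ X ⊆ Y}

/-- `𝒮` is a possible result of the split collection procedure once the sampling loop has found
`𝒮₀`. If there is a balanced cut in `𝒮₀`, one such cut is returned. Otherwise the maximal ones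
among the small cuts are listed in some order `X 0, X 1, …` and each `X i` is replaced by
`X i \ ⋃_{j < i} X j`. -/
inductive SplitCollection (T : Set V) (𝒮₀ : Set (Set V)) : Set (Set V) → Prop
  | balanced (X : Set V) (hX : X ∈ 𝒮₀) (hb : IsBalanced T X) : SplitCollection T 𝒮₀ {X}
  | unbalanced (hb : ∀ X ∈ 𝒮₀, ¬ IsBalanced T X) (k : ℕ) (X : Fin k → Set V)
      (inj : Function.Injective X) (hX : Set.range X = maximalMembers (smallCuts T 𝒮₀)) :
      SplitCollection T 𝒮₀ (Set.range fun i => X i \ ⋃ j, ⋃ _ : j < i, X j)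

end Contract

/-- An input of the algorithm: a finite weighted hypergraph and a set of terminals. -/
structure Problem where
  V : Type u
  E : Type v
  [finV : Finite V]
  [finE : Finite E]
  G : WHypergraph V E
  T : Set V

attribute [instance] Problem.finV Problem.finE

namespace Problem

/-- Contract each member of `𝒞` to an anchor vertex; the terminals are the remaining old terminals
and the anchor vertices. -/
def contract (J : Problem.{u, v}) (𝒞 : Set (Set J.V)) : Problem.{u, v} where
  V := Contracted 𝒞
  E := {e : J.E // (toContracted 𝒞 '' J.G.inc e).Nontrivial}
  G := J.G.contract 𝒞
  T := toContracted 𝒞 '' (J.T ∪ ⋃₀ 𝒞)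

/-- In the call on `J`, for some outcome of the random sampling, the algorithm finds the cuts `𝒮₀`
and selects the collection `𝒮` of splits. No splits are sought when there are at most three
terminals. -/
def Divides (J : Problem.{u, v}) (𝒮₀ 𝒮 : Set (Set J.V)) : Prop :=
  4 ≤ J.T.ncard ∧ ∃ 𝒯 : Set (Set J.V), (∀ T' ∈ 𝒯, T' ⊆ J.T) ∧
    𝒮₀ = J.G.foundCuts J.T 𝒯 ∧ SplitCollection J.T 𝒮₀ 𝒮

/-- `I.Calls J`: in some run of the algorithm on the input `I` there is a (recursive) call on `J`.
A call that selects a nonempty collection `𝒮` calls itself on the parts of the decomposition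
induced by `𝒮`. -/
inductive Calls (I : Problem.{u, v}) : Problem.{u, v} → Prop
  | root : Calls I I
  | part (J : Problem.{u, v}) (hJ : Calls I J) (𝒮₀ 𝒮 : Set (Set J.V)) (h : J.Divides 𝒮₀ 𝒮)
      (X : Set J.V) (hX : X ∈ 𝒮) : Calls I (J.contract {Xᶜ})
  | last (J : Problem.{u, v}) (hJ : Calls I J) (𝒮₀ 𝒮 : Set (Set J.V)) (h : J.Divides 𝒮₀ 𝒮)
      (hne : 𝒮.Nonempty) : Calls I (J.contract 𝒮)

end Problem

end WHypergraph

/-!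
Everything rests on one counting fact. Let `X`, `Z`, `W` be `T`-Steiner mincuts, of value `λ`, such
that each of the four cells `X ∩ Z ∩ W`, `X \ (Z ∪ W)`, `Z \ (X ∪ W)`, `W \ (X ∪ Z)` contains a
terminal. Any two of these cells are separated by exactly two of the three cuts, so a hyperedge
bounding `m` of the cells crosses at least `m` of the cuts, unless it bounds all four cells. The
cells are Steiner cuts, hence `4λ ≤ 3λ + w(D)` for the set `D` of hyperedges bounding all four
cells, and since `D` is contained in each boundary involved, all these boundaries equal `D`
(`boundary_eq_of_four_terminals`).

*Isolating mincuts* (`not_halves_of_isCutOf`). If a global mincut `Q` of `H` has at least two nodes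
of `e` on both sides, then `∂Q = {e}` and every union of branches of `e` is a global mincut of `H`,
so it is realised by a Steiner mincut of `G`. Choosing `Z` and `W` in this way to cross `X`, the
counting fact gives `∂Z = ∂X`, while `Z` contains one but not all branches of `X`. So `X` does not
stay connected when `∂X` is removed, contrary to the definition of a `t`-isolating cut.

*Selected splits* (`not_halves_diff`). Suppose that `X i \ ⋃ j < i, X j` splits the nodes of `e`
evenly. The complement of `X i` then lies in one branch, and another branch outside the split is
covered by earlier cuts; such an earlier cut `X l` lies in a single branch, so it has no terminals
outside `X i`. Uncrossing and the maximality of `X i` as an isolating mincut give `X l ⊆ X i`, which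
was excluded. For the whole family of splits one uses that its members are disjoint: two of them
cannot both contain all branches but one.

*Brittles.* Here every bipartition of `T` is induced by a Steiner mincut. The counting fact shows
that all Steiner mincuts with two terminals on both sides have the same boundary. For the maximal
`{a}`-mincut `X` one first enlarges the three crossing cuts by `X`; their common part has the same
boundary, and by maximality its part connected to `a` is `X`.
-/

namespace WHypergraph

section Cuts

/-! ### Boundaries and uncrossing -/

variable {V : Type u} {E : Type v} {G : WHypergraph V E}

lemma mem_boundary {X : Set V} {e : E} :
    e ∈ G.boundary X ↔ (∃ y ∈ G.inc e, y ∈ X) ∧ ∃ y ∈ G.inc e, y ∉ X := Iff.rfl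

lemma mem_of_notMem_boundary {X : Set V} {e : E} (he : e ∉ G.boundary X) {y z : V}
    (hy : y ∈ G.inc e) (hz : z ∈ G.inc e) (hyX : y ∈ X) : z ∈ X := by
  by_contra h
  exact he ⟨⟨y, hy, hyX⟩, ⟨z, hz, h⟩⟩

lemma boundary_compl (X : Set V) : G.boundary Xᶜ = G.boundary X := by
  ext e
  simp only [mem_boundary, Set.mem_compl_iff, not_not]
  exact and_comm

open Classical in
lemma cutValue_eq_sum [Fintype E] (X : Set V) :
    G.cutValue X = ∑ e, if e ∈ G.boundary X then G.weight e else 0 := by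
  unfold cutValue
  rw [finsum_eq_sum_of_fintype]
  exact Finset.sum_congr rfl fun e _ => finsum_eq_if

lemma cutValue_nonneg (X : Set V) : 0 ≤ G.cutValue X :=
  finsum_nonneg fun e => finsum_nonneg fun _ => (G.weight_pos e).le

open Classical in
/-- A set of hyperedges inside a boundary, of at least the same weight, is the boundary: weights are
positive. -/
lemma eq_boundary_of_subset [Fintype E] {D : Set E} {X : Set V} (h : D ⊆ G.boundary X)
    (hw : G.cutValue X ≤ ∑ e, if e ∈ D then G.weight e else 0) : D = G.boundary X := by
  refine h.antisymm fun f hf => ?_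
  by_contra hfD
  rw [cutValue_eq_sum] at hw
  refine absurd hw (not_le.2 (Finset.sum_lt_sum (fun e _ => ?_) ⟨f, Finset.mem_univ f, ?_⟩))
  · have := (G.weight_pos e).le
    by_cases h1 : e ∈ D
    · simp [h1, h h1]
    · simp only [h1, if_false]
      split_ifs <;> simp [this]
  · simp [hfD, hf, G.weight_pos f]

lemma cutValue_mono [Finite E] {X Y : Set V} (h : G.boundary X ⊆ G.boundary Y) :
    G.cutValue X ≤ G.cutValue Y := by
  classical
  have := Fintype.ofFinite E
  rw [cutValue_eq_sum, cutValue_eq_sum]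
  refine Finset.sum_le_sum fun e _ => ?_
  have := (G.weight_pos e).le
  by_cases h1 : e ∈ G.boundary X
  · simp [h1, h h1]
  · simp only [h1, if_false]
    split_ifs <;> simp [this]

lemma boundary_eq_of_subset [Finite E] {X Y : Set V} (h : G.boundary X ⊆ G.boundary Y)
    (hw : G.cutValue Y ≤ G.cutValue X) : G.boundary X = G.boundary Y := by
  classical
  have := Fintype.ofFinite E
  exact eq_boundary_of_subset h (by rwa [← cutValue_eq_sum])

lemma cutValue_inter_add_cutValue_union_le [Finite E] (X Y : Set V) :
    G.cutValue (X ∩ Y) + G.cutValue (X ∪ Y) ≤ G.cutValue X + G.cutValue Y := by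
  classical
  have := Fintype.ofFinite E
  simp only [cutValue_eq_sum, ← Finset.sum_add_distrib]
  refine Finset.sum_le_sum fun e _ => ?_
  have hw := (G.weight_pos e).le
  have h1 : e ∈ G.boundary (X ∩ Y) → e ∈ G.boundary X ∨ e ∈ G.boundary Y := by
    simp only [mem_boundary, Set.mem_inter_iff]; grind
  have h2 : e ∈ G.boundary (X ∪ Y) → e ∈ G.boundary X ∨ e ∈ G.boundary Y := by
    simp only [mem_boundary, Set.mem_union]; grind
  have h3 : e ∈ G.boundary (X ∩ Y) → e ∈ G.boundary (X ∪ Y) →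
      e ∈ G.boundary X ∧ e ∈ G.boundary Y := by
    simp only [mem_boundary, Set.mem_inter_iff, Set.mem_union]; grind
  split_ifs <;> first | linarith | (exfalso; tauto)

open Classical in
/-- The counting fact for one hyperedge: it bounds at most as many of the four odd cells of three
cuts as it crosses cuts, up to one more if it bounds all four cells. -/
lemma sum_cells_le (X Z W : Set V) {D : Set E} {e : E}
    (hD : e ∈ D ↔ (e ∈ G.boundary (X ∩ Z ∩ W) ∧ e ∈ G.boundary (X \ (Z ∪ W))) ∧
      e ∈ G.boundary (Z \ (X ∪ W)) ∧ e ∈ G.boundary (W \ (X ∪ Z))) :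
    ((if e ∈ G.boundary (X ∩ Z ∩ W) then G.weight e else 0) +
      (if e ∈ G.boundary (X \ (Z ∪ W)) then G.weight e else 0)) +
      ((if e ∈ G.boundary (Z \ (X ∪ W)) then G.weight e else 0) +
      (if e ∈ G.boundary (W \ (X ∪ Z)) then G.weight e else 0)) ≤
    ((if e ∈ G.boundary X then G.weight e else 0) +
      (if e ∈ G.boundary Z then G.weight e else 0)) +
      ((if e ∈ G.boundary W then G.weight e else 0) +
      (if e ∈ D then G.weight e else 0)) := by
  have hw := (G.weight_pos e).le
  -- a bounded cell contains a vertex of `e`, and another vertex of `e` lies in another cell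
  have h1 : e ∈ G.boundary (X ∩ Z ∩ W) →
      e ∈ G.boundary X ∨ e ∈ G.boundary Z ∨ e ∈ G.boundary W := by
    simp only [mem_boundary, Set.mem_inter_iff]; grind
  have h2 : e ∈ G.boundary (X \ (Z ∪ W)) →
      e ∈ G.boundary X ∨ e ∈ G.boundary Z ∨ e ∈ G.boundary W := by
    simp only [mem_boundary, Set.mem_sdiff, Set.mem_union]; grind
  have h3 : e ∈ G.boundary (Z \ (X ∪ W)) →
      e ∈ G.boundary X ∨ e ∈ G.boundary Z ∨ e ∈ G.boundary W := by
    simp only [mem_boundary, Set.mem_sdiff, Set.mem_union]; grind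
  have h4 : e ∈ G.boundary (W \ (X ∪ Z)) →
      e ∈ G.boundary X ∨ e ∈ G.boundary Z ∨ e ∈ G.boundary W := by
    simp only [mem_boundary, Set.mem_sdiff, Set.mem_union]; grind
  -- two bounded cells are separated by two of the cuts
  have h12 : e ∈ G.boundary (X ∩ Z ∩ W) → e ∈ G.boundary (X \ (Z ∪ W)) →
      e ∈ G.boundary Z ∧ e ∈ G.boundary W := by
    simp only [mem_boundary, Set.mem_sdiff, Set.mem_union, Set.mem_inter_iff]; grind
  have h13 : e ∈ G.boundary (X ∩ Z ∩ W) → e ∈ G.boundary (Z \ (X ∪ W)) →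
      e ∈ G.boundary X ∧ e ∈ G.boundary W := by
    simp only [mem_boundary, Set.mem_sdiff, Set.mem_union, Set.mem_inter_iff]; grind
  have h14 : e ∈ G.boundary (X ∩ Z ∩ W) → e ∈ G.boundary (W \ (X ∪ Z)) →
      e ∈ G.boundary X ∧ e ∈ G.boundary Z := by
    simp only [mem_boundary, Set.mem_sdiff, Set.mem_union, Set.mem_inter_iff]; grind
  have h23 : e ∈ G.boundary (X \ (Z ∪ W)) → e ∈ G.boundary (Z \ (X ∪ W)) →
      e ∈ G.boundary X ∧ e ∈ G.boundary Z := by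
    simp only [mem_boundary, Set.mem_sdiff, Set.mem_union]; grind
  have h24 : e ∈ G.boundary (X \ (Z ∪ W)) → e ∈ G.boundary (W \ (X ∪ Z)) →
      e ∈ G.boundary X ∧ e ∈ G.boundary W := by
    simp only [mem_boundary, Set.mem_sdiff, Set.mem_union]; grind
  have h34 : e ∈ G.boundary (Z \ (X ∪ W)) → e ∈ G.boundary (W \ (X ∪ Z)) →
      e ∈ G.boundary Z ∧ e ∈ G.boundary W := by
    simp only [mem_boundary, Set.mem_sdiff, Set.mem_union]; grind
  generalize (e ∈ G.boundary (X ∩ Z ∩ W)) = p1 at *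
  generalize (e ∈ G.boundary (X \ (Z ∪ W))) = p2 at *
  generalize (e ∈ G.boundary (Z \ (X ∪ W))) = p3 at *
  generalize (e ∈ G.boundary (W \ (X ∪ Z))) = p4 at *
  generalize (e ∈ G.boundary X) = q1 at *
  generalize (e ∈ G.boundary Z) = q2 at *
  generalize (e ∈ G.boundary W) = q3 at *
  generalize (e ∈ D) = d at *
  by_cases p1 <;> by_cases p2 <;> by_cases p3 <;> by_cases p4 <;> simp_all <;>
    (try split_ifs) <;> first | linarith | (exfalso; tauto)

lemma IsSteinerMincut.cutValue_eq {T X Y : Set V} (hX : G.IsSteinerMincut T X)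
    (hY : G.IsSteinerMincut T Y) : G.cutValue X = G.cutValue Y :=
  le_antisymm (hX.2 Y hY.1) (hY.2 X hX.1)

/-- Three Steiner mincuts, each odd cell of which contains a terminal, have the same boundary, and
it is also the boundary of their intersection. -/
theorem boundary_eq_of_four_terminals [Finite E] {T X Z W : Set V} (hX : G.IsSteinerMincut T X)
    (hZ : G.IsSteinerMincut T Z) (hW : G.IsSteinerMincut T W)
    (h1 : ∃ t ∈ T, t ∈ X ∧ t ∈ Z ∧ t ∈ W) (h2 : ∃ t ∈ T, t ∈ X ∧ t ∉ Z ∧ t ∉ W)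
    (h3 : ∃ t ∈ T, t ∉ X ∧ t ∈ Z ∧ t ∉ W) (h4 : ∃ t ∈ T, t ∉ X ∧ t ∉ Z ∧ t ∈ W) :
    G.boundary Z = G.boundary X ∧ G.boundary (X ∩ Z ∩ W) = G.boundary X := by
  classical
  have := Fintype.ofFinite E
  obtain ⟨t1, m1, a1, b1, c1⟩ := h1
  obtain ⟨t2, m2, a2, b2, c2⟩ := h2
  obtain ⟨t3, m3, a3, b3, c3⟩ := h3
  obtain ⟨t4, m4, a4, b4, c4⟩ := h4
  have s1 := hX.2 (X ∩ Z ∩ W) ⟨⟨t1, m1, by simp [*]⟩, ⟨t2, m2, by simp [*]⟩⟩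
  have s2 := hX.2 (X \ (Z ∪ W)) ⟨⟨t2, m2, by simp [*]⟩, ⟨t1, m1, by simp [*]⟩⟩
  have s3 := hX.2 (Z \ (X ∪ W)) ⟨⟨t3, m3, by simp [*]⟩, ⟨t1, m1, by simp [*]⟩⟩
  have s4 := hX.2 (W \ (X ∪ Z)) ⟨⟨t4, m4, by simp [*]⟩, ⟨t1, m1, by simp [*]⟩⟩
  have eZ := hZ.cutValue_eq hX
  have eW := hW.cutValue_eq hX
  obtain ⟨D, hD⟩ : ∃ D, D = (G.boundary (X ∩ Z ∩ W) ∩ G.boundary (X \ (Z ∪ W))) ∩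
    (G.boundary (Z \ (X ∪ W)) ∩ G.boundary (W \ (X ∪ Z))) := ⟨_, rfl⟩
  have key : (G.cutValue (X ∩ Z ∩ W) + G.cutValue (X \ (Z ∪ W))) +
      (G.cutValue (Z \ (X ∪ W)) + G.cutValue (W \ (X ∪ Z))) ≤
      (G.cutValue X + G.cutValue Z) +
        (G.cutValue W + ∑ e, if e ∈ D then G.weight e else 0) := by
    simp only [cutValue_eq_sum, ← Finset.sum_add_distrib]
    exact Finset.sum_le_sum fun e _ => sum_cells_le X Z W (hD ▸ Iff.rfl)
  have hDX : D ⊆ G.boundary X := by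
    rw [hD]
    rintro e ⟨⟨⟨⟨y, hy, hyX⟩, -⟩, -⟩, ⟨⟨⟨z, hz, hzX⟩, -⟩, -⟩⟩
    exact ⟨⟨y, hy, hyX.1.1⟩, ⟨z, hz, fun h => hzX.2 (Or.inl h)⟩⟩
  have hDZ : D ⊆ G.boundary Z := by
    rw [hD]
    rintro e ⟨⟨⟨⟨y, hy, hyX⟩, -⟩, ⟨⟨z, hz, hzX⟩, -⟩⟩, -⟩
    exact ⟨⟨y, hy, hyX.1.2⟩, ⟨z, hz, fun h => hzX.2 (Or.inl h)⟩⟩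
  have hD1 : D ⊆ G.boundary (X ∩ Z ∩ W) := fun e he => (hD ▸ he).1.1
  have eX : D = G.boundary X := eq_boundary_of_subset hDX (by linarith)
  have hwD : (∑ e, if e ∈ D then G.weight e else 0) = G.cutValue X := by
    rw [eX, cutValue_eq_sum]
  exact ⟨(eq_boundary_of_subset hDZ (by linarith)).symm.trans eX,
    (eq_boundary_of_subset hD1 (by linarith)).symm.trans eX⟩

lemma IsSteinerMincut.union [Finite E] {T X Y : Set V} (hX : G.IsSteinerMincut T X)
    (hY : G.IsSteinerMincut T Y) (h1 : ∃ t ∈ T, t ∈ X ∧ t ∈ Y) (h2 : ∃ t ∈ T, t ∉ X ∧ t ∉ Y) :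
    G.IsSteinerMincut T (X ∪ Y) := by
  obtain ⟨t, ht, htX, htY⟩ := h1
  obtain ⟨s, hs, hsX, hsY⟩ := h2
  have hi := hY.2 (X ∩ Y) ⟨⟨t, ht, htX, htY⟩, ⟨s, hs, fun h => hsX h.1⟩⟩
  have hsub := G.cutValue_inter_add_cutValue_union_le X Y
  refine ⟨⟨⟨t, ht, Or.inl htX⟩, ⟨s, hs, by simp [*]⟩⟩, fun R hR => ?_⟩
  have := hX.2 R hR
  linarith

lemma steinerValue_le {T Y : Set V} (hY : IsSteinerCut T Y) : G.steinerValue T ≤ G.cutValue Y :=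
  csInf_le ⟨0, by rintro _ ⟨X, -, rfl⟩; exact cutValue_nonneg X⟩ ⟨Y, hY, rfl⟩

/-! ### Reachability and `A`-cuts -/

lemma Reach.mono {D D' : Set E} (h : D ⊆ D') {a b : V} (hr : G.Reach D a b) : G.Reach D' a b :=
  Relation.ReflTransGen.mono (fun _ _ ⟨e, he, h1, h2⟩ => ⟨e, h he, h1, h2⟩) _ _ hr

lemma Reach.symm {D : Set E} {a b : V} (hr : G.Reach D a b) : G.Reach D b a := by
  have : Std.Symm fun y z => ∃ e ∈ D, y ∈ G.inc e ∧ z ∈ G.inc e :=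
    ⟨fun _ _ ⟨e, he, h1, h2⟩ => ⟨e, he, h2, h1⟩⟩
  exact Relation.ReflTransGen.stdSymm.symm _ _ hr

lemma Reach.trans {D : Set E} {a b c : V} (h1 : G.Reach D a b) (h2 : G.Reach D b c) :
    G.Reach D a c := Relation.ReflTransGen.trans h1 h2

lemma reach_of_mem {D : Set E} {e : E} (he : e ∈ D) {a b : V} (ha : a ∈ G.inc e)
    (hb : b ∈ G.inc e) : G.Reach D a b := Relation.ReflTransGen.single ⟨e, he, ha, hb⟩

lemma Reach.mem {D : Set E} {S : Set V} (hS : ∀ e ∈ D, e ∉ G.boundary S) {a b : V}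
    (hr : G.Reach D a b) (ha : a ∈ S) : b ∈ S := by
  induction hr with
  | refl => exact ha
  | tail _ h ih =>
    obtain ⟨e, he, h1, h2⟩ := h
    exact mem_of_notMem_boundary (hS e he) h1 h2 ih

/-- A path that starts in `X` and avoids `∂X` stays inside `X`, so it avoids the boundary of every
larger set. -/
lemma Reach.of_subset {X Y : Set V} (h : X ⊆ Y) {a b : V} (hr : G.Reach (G.boundary X)ᶜ a b)
    (ha : a ∈ X) : G.Reach (G.boundary Y)ᶜ a b := by
  have hb : b ∈ X ∧ G.Reach (G.boundary Y)ᶜ a b := by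
    induction hr with
    | refl => exact ⟨ha, Relation.ReflTransGen.refl⟩
    | tail _ h' ih =>
      obtain ⟨e, he, h1, h2⟩ := h'
      refine ⟨mem_of_notMem_boundary he h1 h2 ih.1, ih.2.trans (reach_of_mem ?_ h1 h2)⟩
      rintro ⟨-, z, hz, hzY⟩
      exact hzY (h (mem_of_notMem_boundary he h1 hz ih.1))
  exact hb.2

lemma IsCutOf.steinerCut {T A X : Set V} (h : G.IsCutOf T A X) : IsSteinerCut T X := by
  obtain ⟨⟨a, ha⟩, hAT, hAX, hd, -⟩ := h
  obtain ⟨s, hs, hsA⟩ := Set.exists_of_ssubset hAT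
  exact ⟨⟨a, hAT.1 ha, hAX ha⟩, ⟨s, hs, Set.disjoint_left.1 hd ⟨hs, hsA⟩⟩⟩

lemma IsCutOf.inter_eq {T A X : Set V} (h : G.IsCutOf T A X) : T ∩ X = A := by
  obtain ⟨-, hAT, hAX, hd, -⟩ := h
  ext y
  refine ⟨fun hy => ?_, fun hy => ⟨hAT.1 hy, hAX hy⟩⟩
  by_contra hyA
  exact Set.disjoint_left.1 hd ⟨hy.1, hyA⟩ hy.2

/-- A set `S` that separates `A` from the other terminals contains an `A`-cut whose boundary lies in
`∂S`: its vertices that remain connected to `A` after the removal of `∂S`. -/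
lemma isCutOf_reachable {T A S : Set V} (hA : A.Nonempty) (hAT : A ⊂ T) (hAS : A ⊆ S)
    (hd : Disjoint (T \ A) S) :
    G.IsCutOf T A {y | y ∈ S ∧ ∃ a ∈ A, G.Reach (G.boundary S)ᶜ y a} ∧
      G.boundary {y | y ∈ S ∧ ∃ a ∈ A, G.Reach (G.boundary S)ᶜ y a} ⊆ G.boundary S := by
  have hb : G.boundary {y | y ∈ S ∧ ∃ a ∈ A, G.Reach (G.boundary S)ᶜ y a} ⊆ G.boundary S := by
    rintro e ⟨⟨y, hy, hyS, a, ha, hr⟩, ⟨z, hz, hzR⟩⟩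
    by_contra he
    exact hzR ⟨mem_of_notMem_boundary he hy hz hyS, a, ha, (reach_of_mem he hz hy).trans hr⟩
  refine ⟨⟨hA, hAT, fun a ha => ⟨hAS ha, a, ha, Relation.ReflTransGen.refl⟩,
    hd.mono_right fun y hy => hy.1, ?_⟩, hb⟩
  rintro y ⟨-, a, ha, hr⟩
  exact ⟨a, ha, hr.mono (Set.compl_subset_compl.2 hb)⟩

lemma exists_isMincutOf [Finite V] {T A : Set V} (hA : A.Nonempty) (hAT : A ⊂ T) :
    ∃ X, G.IsMincutOf T A X := by
  obtain ⟨X, hX, hmin⟩ := Set.exists_min_image {X | G.IsCutOf T A X} G.cutValue (Set.toFinite _)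
    ⟨A, hA, hAT, subset_rfl, Set.disjoint_sdiff_left,
      fun a ha => ⟨a, ha, Relation.ReflTransGen.refl⟩⟩
  exact ⟨X, hX, hmin⟩

/-- An `A`-cut stays one when a set is added that contains no further terminals and whose vertices
are connected, within it, to vertices of the cut. -/
lemma IsCutOf.union {T A X Y : Set V} (hX : G.IsCutOf T A X) (hY : T ∩ Y ⊆ X)
    (hr : ∀ y ∈ Y, ∃ b ∈ X, G.Reach (G.boundary Y)ᶜ y b) : G.IsCutOf T A (X ∪ Y) := by
  obtain ⟨hA, hAT, hAX, hd, hc⟩ := hX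
  refine ⟨hA, hAT, hAX.trans Set.subset_union_left, ?_, ?_⟩
  · rw [Set.disjoint_left] at hd ⊢
    rintro s hs (h | h)
    · exact hd hs h
    · exact hd hs (hY ⟨hs.1, h⟩)
  · have hc' : ∀ y ∈ X, ∃ a ∈ A, G.Reach (G.boundary (X ∪ Y))ᶜ y a := fun y hy =>
      let ⟨a, ha, h⟩ := hc y hy
      ⟨a, ha, h.of_subset Set.subset_union_left hy⟩
    rintro y (hy | hy)
    · exact hc' y hy
    · obtain ⟨b, hb, h⟩ := hr y hy
      obtain ⟨a, ha, h'⟩ := hc' b hb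
      exact ⟨a, ha, (h.of_subset Set.subset_union_right hy).trans h'⟩

/-- If a Steiner mincut that is a cut of some terminal set has no terminals outside a maximal
isolating mincut that is also a Steiner mincut, then it is contained in that cut. -/
lemma IsMaxMincutOf.subset_of_inter_subset [Finite E] {T T' T'' A B X Y : Set V} (hT' : T' ⊆ T)
    (hX : G.IsMaxMincutOf T' A X) (hXm : G.IsSteinerMincut T X) (hB : B ⊆ T)
    (hY : G.IsCutOf T'' B Y) (hYm : G.IsSteinerMincut T Y) (h : T ∩ Y ⊆ X) : Y ⊆ X := by
  have hBX : ∀ b ∈ B, b ∈ X := fun b hb => h ⟨hB hb, hY.2.2.1 hb⟩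
  obtain ⟨t, ht, htY⟩ := hYm.1.1
  obtain ⟨s, hs, hsX⟩ := hXm.1.2
  have hu := hXm.union hYm ⟨t, ht, h ⟨ht, htY⟩, htY⟩ ⟨s, hs, hsX, fun hsY => hsX (h ⟨hs, hsY⟩)⟩
  have hc : G.IsCutOf T' A (X ∪ Y) := hX.1.1.union (fun s hs => h ⟨hT' hs.1, hs.2⟩)
    fun y hy => let ⟨b, hb, hr⟩ := hY.2.2.2.2 y hy; ⟨b, hBX b hb, hr⟩
  refine Set.subset_union_right.trans (hX.2 _ ⟨hc, fun R hR => ?_⟩)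
  rw [hu.cutValue_eq hXm]
  exact hX.1.2 R hR

lemma exists_isMaxMincutOf [Finite V] [Finite E] {T A : Set V} (hA : A.Nonempty) (hAT : A ⊂ T)
    (h : ∀ X, G.IsMincutOf T A X → G.IsSteinerMincut T X) : ∃ X, G.IsMaxMincutOf T A X := by
  obtain ⟨X, hX⟩ := (Set.toFinite {X | G.IsMincutOf T A X}).exists_maximal
    (exists_isMincutOf hA hAT)
  refine ⟨X, hX.prop, fun Y hY => ?_⟩
  obtain ⟨a, ha⟩ := hA
  obtain ⟨s, hs, hsA⟩ := Set.exists_of_ssubset hAT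
  have hd : ∀ {Z}, G.IsMincutOf T A Z → s ∉ Z := fun hZ hsZ =>
    hsA (hZ.1.inter_eq.subset ⟨hs, hsZ⟩)
  have hu := (h X hX.prop).union (h Y hY) ⟨a, hAT.1 ha, hX.prop.1.2.2.1 ha, hY.1.2.2.1 ha⟩
    ⟨s, hs, hd hX.prop, hd hY⟩
  have hc : G.IsCutOf T A (X ∪ Y) := hX.prop.1.union
    (hY.1.inter_eq.subset.trans hX.prop.1.2.2.1)
    fun y hy => let ⟨b, hb, hr⟩ := hY.1.2.2.2.2 y hy; ⟨b, hX.prop.1.2.2.1 hb, hr⟩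
  have hm : G.IsMincutOf T A (X ∪ Y) := ⟨hc, fun R hR => hu.2 R hR.steinerCut⟩
  exact Set.subset_union_right.trans (hX.le_of_ge hm Set.subset_union_left)

end Cuts

section Branches

/-! ### Branches of a hyperedge of a hypercactus -/

variable {W : Type w} {F : Type x} {H : WHypergraph W F}

lemma IsHypercactus.reach (hH : H.IsHypercactus) (y z : W) : H.Reach Set.univ y z := by
  cases hH with
  | intro _ _ _ _ _ hc => exact hc y trivial z trivial

lemma IsHypercactus.ncard_components (hH : H.IsHypercactus) {e : F} (he : 3 ≤ H.rank e) :
    (H.components Set.univ (Set.univ \ {e})).ncard = H.rank e := by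
  cases hH with
  | intro _ _ _ _ _ _ _ _ hn => exact hn e trivial he

/-- The union of the branches of `e` (the components of `H - e`) at the nodes in `I`. -/
def branches (H : WHypergraph W F) (e : F) (I : Set W) : Set W :=
  {z | ∃ y ∈ I, H.Reach {e}ᶜ y z}

lemma IsHypercactus.exists_reach (hH : H.IsHypercactus) {e : F} (he : (H.inc e).Nonempty) (z : W) :
    ∃ y ∈ H.inc e, H.Reach {e}ᶜ y z := by
  obtain ⟨y₀, hy₀⟩ := he
  have hr := hH.reach y₀ z
  induction hr with
  | refl => exact ⟨y₀, hy₀, Relation.ReflTransGen.refl⟩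
  | tail _ h ih =>
    obtain ⟨f, -, h1, h2⟩ := h
    by_cases hf : f = e
    · subst hf
      exact ⟨_, h2, Relation.ReflTransGen.refl⟩
    · obtain ⟨y, hy, hr⟩ := ih
      exact ⟨y, hy, hr.trans (reach_of_mem hf h1 h2)⟩

/-- Distinct nodes of `e` lie in distinct branches, as there are as many branches as nodes. -/
lemma IsHypercactus.eq_of_reach [Finite W] (hH : H.IsHypercactus) {e : F} (he : 3 ≤ H.rank e)
    {y z : W} (hy : y ∈ H.inc e) (hz : z ∈ H.inc e) (hr : H.Reach {e}ᶜ y z) : y = z := by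
  have hne : (H.inc e).Nonempty := ⟨y, hy⟩
  have himg : (fun y => {z | H.Reach {e}ᶜ y z}) '' H.inc e =
      H.components Set.univ (Set.univ \ {e}) := by
    ext C
    constructor
    · rintro ⟨y, -, rfl⟩
      exact ⟨y, trivial, by simp [Set.compl_eq_univ_sdiff]⟩
    · rintro ⟨z, -, rfl⟩
      obtain ⟨y, hy, hyz⟩ := hH.exists_reach hne z
      refine ⟨y, hy, ?_⟩
      ext v
      simp only [Set.mem_ofPred_eq, Set.mem_univ, true_and, ← Set.compl_eq_univ_sdiff]
      exact ⟨fun h => hyz.symm.trans h, fun h => hyz.trans h⟩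
  have hinj : Set.InjOn (fun y => {z | H.Reach {e}ᶜ y z}) (H.inc e) := by
    rw [← Set.ncard_image_iff (Set.toFinite _), himg]
    exact hH.ncard_components he
  refine hinj hy hz ?_
  ext v
  exact ⟨fun h => hr.symm.trans h, fun h => hr.trans h⟩

lemma inc_nonempty_of_rank {e : F} (he : 3 ≤ H.rank e) : (H.inc e).Nonempty := by
  refine Set.nonempty_of_ncard_ne_zero ?_
  unfold rank at he
  omega

lemma boundary_branches_subset {e : F} (I : Set W) : H.boundary (H.branches e I) ⊆ {e} := by
  rintro f ⟨⟨a, ha, y, hy, hr⟩, ⟨b, hb, hbI⟩⟩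
  by_contra hf
  exact hbI ⟨y, hy, hr.trans (reach_of_mem hf ha hb)⟩

lemma IsHypercactus.mem_branches_iff [Finite W] (hH : H.IsHypercactus) {e : F}
    (he : 3 ≤ H.rank e) {I : Set W} (hI : I ⊆ H.inc e) {y z : W} (hy : y ∈ H.inc e)
    (h : H.Reach {e}ᶜ y z) : z ∈ H.branches e I ↔ y ∈ I := by
  refine ⟨?_, fun hyI => ⟨y, hyI, h⟩⟩
  rintro ⟨x, hx, hxz⟩
  rwa [← hH.eq_of_reach he (hI hx) hy (hxz.trans h.symm)]

lemma IsHypercactus.boundary_branches [Finite W] (hH : H.IsHypercactus) {e : F}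
    (he : 3 ≤ H.rank e) {I : Set W} (hI : I ⊂ H.inc e) (hne : I.Nonempty) :
    H.boundary (H.branches e I) = {e} := by
  refine (boundary_branches_subset I).antisymm (Set.singleton_subset_iff.2 ?_)
  obtain ⟨y, hy⟩ := hne
  obtain ⟨z, hz, hzI⟩ := Set.exists_of_ssubset hI
  exact ⟨⟨y, hI.1 hy, y, hy, Relation.ReflTransGen.refl⟩, ⟨z, hz, fun h =>
    hzI ((hH.mem_branches_iff he hI.1 hz Relation.ReflTransGen.refl).1 h)⟩⟩

lemma cutValue_of_boundary_eq {e : F} {Q : Set W} (h : H.boundary Q = {e}) :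
    H.cutValue Q = H.weight e := by
  unfold cutValue
  rw [h, finsum_mem_singleton]

lemma IsGlobalMincut.compl {Q : Set W} (hQ : H.IsGlobalMincut Q) : H.IsGlobalMincut Qᶜ := by
  obtain ⟨h1, h2, h3⟩ := hQ
  refine ⟨Set.nonempty_compl.2 h2, fun h => h1.ne_empty (Set.compl_univ_iff.1 h), fun R hR hR' => ?_⟩
  have : H.cutValue Qᶜ = H.cutValue Q := by unfold cutValue; rw [boundary_compl]
  exact this ▸ h3 R hR hR'

lemma ne_univ_of_mem_boundary {e : F} {Q : Set W} (h : e ∈ H.boundary Q) : Q ≠ Set.univ := by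
  rintro rfl
  obtain ⟨-, z, -, hz⟩ := h
  exact hz trivial

lemma nonempty_of_mem_boundary {e : F} {Q : Set W} (h : e ∈ H.boundary Q) : Q.Nonempty :=
  let ⟨⟨y, _, hy⟩, _⟩ := h; ⟨y, hy⟩

/-- A global mincut that crosses `e` crosses nothing else, since a single branch is cut off by
`e`. -/
lemma IsGlobalMincut.boundary_eq [Finite W] [Finite F] (hH : H.IsHypercactus) {e : F}
    (he : 3 ≤ H.rank e) {Q : Set W} (hQ : H.IsGlobalMincut Q) (heQ : e ∈ H.boundary Q) :
    H.boundary Q = {e} := by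
  obtain ⟨y, hy⟩ := inc_nonempty_of_rank he
  have hss : ({y} : Set W) ⊂ H.inc e := by
    refine (Set.ssubset_iff_subset_ne.2 ⟨Set.singleton_subset_iff.2 hy, fun h => ?_⟩)
    unfold rank at he
    rw [← h, Set.ncard_singleton] at he
    omega
  have hb := hH.boundary_branches he hss (Set.singleton_nonempty y)
  have heb : e ∈ H.boundary (H.branches e {y}) := by rw [hb]; rfl
  rw [← hb]
  refine (boundary_eq_of_subset ?_
    (hQ.2.2 _ (nonempty_of_mem_boundary heb) (ne_univ_of_mem_boundary heb))).symm
  rw [hb]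
  exact Set.singleton_subset_iff.2 heQ

lemma IsGlobalMincut.of_boundary_eq {e : F} {Q R : Set W} (hQ : H.IsGlobalMincut Q)
    (hQe : H.boundary Q = {e}) (hR : H.boundary R = {e}) : H.IsGlobalMincut R := by
  have heR : e ∈ H.boundary R := by rw [hR]; rfl
  refine ⟨nonempty_of_mem_boundary heR, ne_univ_of_mem_boundary heR, fun S hS hS' => ?_⟩
  rw [cutValue_of_boundary_eq hR, ← cutValue_of_boundary_eq hQe]
  exact hQ.2.2 S hS hS'

lemma Reach.mem_iff_of_boundary_eq {e : F} {Q : Set W} (hQ : H.boundary Q = {e}) {y z : W}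
    (h : H.Reach {e}ᶜ y z) : y ∈ Q ↔ z ∈ Q := by
  have hQ' : ∀ f ∈ ({e}ᶜ : Set F), f ∉ H.boundary Q := fun f hf => by rwa [hQ]
  exact ⟨h.mem hQ', h.symm.mem hQ'⟩

/-- A global mincut `Q` that avoids `e` lies in one branch of `e`. -/
lemma IsGlobalMincut.subset_branch [Finite W] [Finite F] (hH : H.IsHypercactus) {e : F}
    (he : 3 ≤ H.rank e) {Q : Set W} (hQ : H.IsGlobalMincut Q) (heQ : Disjoint (H.inc e) Q) :
    ∃ k ∈ H.inc e, Q ⊆ H.branches e {k} := by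
  obtain ⟨q, hq⟩ := hQ.1
  obtain ⟨k, hk, hkq⟩ := hH.exists_reach (inc_nonempty_of_rank he) q
  refine ⟨k, hk, ?_⟩
  by_contra hnot
  obtain ⟨p, hp, hpk⟩ := Set.not_subset.1 hnot
  set B := H.branches e {k} with hB
  have hfB : ∀ f, f ≠ e → f ∉ H.boundary B := fun f hf h => hf (boundary_branches_subset _ h)
  have hqB : q ∈ B := ⟨k, rfl, hkq⟩
  have hne : ∀ f u, u ∈ H.inc f → u ∈ Q → f ≠ e := by
    rintro f u hu huQ rfl
    exact Set.disjoint_left.1 heQ hu huQ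
  -- the parts of `Q` inside and outside the branch are mincuts with the same boundary as `Q`
  have h1 : H.boundary (Q ∩ B) = H.boundary Q := by
    refine boundary_eq_of_subset ?_ (hQ.2.2 _ ⟨q, hq, hqB⟩ fun h => hpk (h ▸ Set.mem_univ p :
      p ∈ Q ∩ B).2)
    rintro f ⟨⟨u, hu, huQ, huB⟩, ⟨v, hv, hvQB⟩⟩
    have hf := hfB f (hne f u hu huQ)
    exact ⟨⟨u, hu, huQ⟩, ⟨v, hv, fun h => hvQB ⟨h, mem_of_notMem_boundary hf hu hv huB⟩⟩⟩
  have h2 : H.boundary (Q \ B) = H.boundary Q := by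
    refine boundary_eq_of_subset ?_ (hQ.2.2 _ ⟨p, hp, hpk⟩ fun h => (h ▸ Set.mem_univ q :
      q ∈ Q \ B).2 hqB)
    rintro f ⟨⟨u, hu, huQ, huB⟩, ⟨v, hv, hvQB⟩⟩
    have hf := hfB f (hne f u hu huQ)
    exact ⟨⟨u, hu, huQ⟩, ⟨v, hv, fun h => hvQB ⟨h, fun hvB =>
      huB (mem_of_notMem_boundary hf hv hu hvB)⟩⟩⟩
  obtain ⟨f, hf⟩ : (H.boundary Q).Nonempty := by
    by_contra hemp
    rw [Set.not_nonempty_iff_eq_empty] at hemp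
    refine hQ.2.1 (Set.eq_univ_of_forall fun z => ?_)
    exact (hH.reach q z).mem (S := Q) (by simp [hemp]) hq
  obtain ⟨⟨u, hu, huQ, huB⟩, -⟩ := h1.symm ▸ hf
  obtain ⟨⟨v, hv, hvQ, hvB⟩, -⟩ := h2.symm ▸ hf
  exact hvB (mem_of_notMem_boundary (hfB f (hne f u hu huQ)) hu hv huB)

/-- At least two nodes of `e` lie on both sides of `Q`. -/
def Halves (H : WHypergraph W F) (Q : Set W) (e : F) : Prop :=
  (H.inc e ∩ Q).Nontrivial ∧ (H.inc e \ Q).Nontrivial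

lemma Halves.compl {Q : Set W} {e : F} (h : H.Halves Q e) : H.Halves Qᶜ e := by
  refine ⟨h.2, ?_⟩
  rw [Set.sdiff_compl]
  exact h.1

lemma Halves.mem_boundary {Q : Set W} {e : F} (h : H.Halves Q e) : e ∈ H.boundary Q :=
  ⟨h.1.nonempty, h.2.nonempty⟩

/-- A global mincut that meets two branches of `e`, without halving `e`, contains all branches but
one. -/
lemma IsGlobalMincut.compl_subset_branch [Finite W] [Finite F] (hH : H.IsHypercactus) {e : F}
    (he : 3 ≤ H.rank e) {Q : Set W} (hQ : H.IsGlobalMincut Q) (hh : ¬ H.Halves Q e) {y z p q : W}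
    (hy : y ∈ H.inc e) (hz : z ∈ H.inc e) (hyz : y ≠ z) (hyp : H.Reach {e}ᶜ y p)
    (hzq : H.Reach {e}ᶜ z q) (hp : p ∈ Q) (hq : q ∈ Q) :
    ∃ k ∈ H.inc e, Qᶜ ⊆ H.branches e {k} := by
  by_cases heQ : e ∈ H.boundary Q
  · have hb := hQ.boundary_eq hH he heQ
    obtain ⟨k, hk, hkQ⟩ := heQ.2
    have hnt : (H.inc e ∩ Q).Nontrivial := ⟨y, ⟨hy, (hyp.mem_iff_of_boundary_eq hb).2 hp⟩,
      z, ⟨hz, (hzq.mem_iff_of_boundary_eq hb).2 hq⟩, hyz⟩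
    have hs : (H.inc e \ Q).Subsingleton := Set.not_nontrivial_iff.1 fun h => hh ⟨hnt, h⟩
    refine ⟨k, hk, fun u hu => ?_⟩
    obtain ⟨x, hx, hxu⟩ := hH.exists_reach ⟨y, hy⟩ u
    have hxk : x = k := hs ⟨hx, fun h => hu ((hxu.mem_iff_of_boundary_eq hb).1 h)⟩ ⟨hk, hkQ⟩
    exact ⟨x, hxk, hxu⟩
  · by_cases hd : Disjoint (H.inc e) Q
    · obtain ⟨k, hk, hsub⟩ := hQ.subset_branch hH he hd
      have hks : ({k} : Set W) ⊆ H.inc e := Set.singleton_subset_iff.2 hk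
      exact absurd (((hH.mem_branches_iff he hks hy hyp).1 (hsub hp)).trans
        ((hH.mem_branches_iff he hks hz hzq).1 (hsub hq)).symm) hyz
    · refine hQ.compl.subset_branch hH he ?_
      obtain ⟨u, hu, huQ⟩ := Set.not_disjoint_iff.1 hd
      exact Set.disjoint_left.2 fun v hv hvQ => hvQ (mem_of_notMem_boundary heQ hu hv huQ)

end Branches

section Steiner

/-! ### Steiner mincuts realised by a hypercactus -/

variable {V : Type u} {E : Type v} {W : Type w} {F : Type x} {G : WHypergraph V E} {T : Set V}
  {H : WHypergraph W F} {φ : V → W}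

lemma Corresponds.mem_iff {X : Set V} {Q : Set W} (h : Corresponds T H φ X Q) {t : V}
    (ht : t ∈ T) : φ t ∈ Q ↔ t ∈ X := by
  refine ⟨fun hQ => ?_, fun hX => h.2.1 ⟨t, ⟨hX, ht⟩, rfl⟩⟩
  by_contra hX
  exact Set.disjoint_left.1 h.2.2 ⟨t, ⟨ht, hX⟩, rfl⟩ hQ

lemma IsSteinerHypercactus.exists_isSteinerMincut [Finite V] (hS : IsSteinerHypercactus G T H φ)
    {Q : Set W} (hQ : H.IsGlobalMincut Q) (h1 : ∃ t ∈ T, φ t ∈ Q) (h2 : ∃ t ∈ T, φ t ∉ Q) :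
    ∃ X, G.IsSteinerMincut T X ∧ ∀ t ∈ T, t ∈ X ↔ φ t ∈ Q := by
  obtain ⟨t, ht, htQ⟩ := h1
  obtain ⟨s, hs, hsQ⟩ := h2
  obtain ⟨X, hX⟩ := exists_isMincutOf (G := G) (T := T) (A := {t | t ∈ T ∧ φ t ∈ Q}) ⟨t, ht, htQ⟩
    ⟨fun t h => h.1, fun h => hsQ (h hs).2⟩
  refine ⟨X, (hS.mincut_iff _ X hX).2 ⟨Q, hQ, ?_, ?_⟩, fun t ht => ?_⟩
  · rintro _ ⟨t, h, rfl⟩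
    exact h.2
  · rw [Set.disjoint_left]
    rintro _ ⟨t, h, rfl⟩ h'
    exact h.2 ⟨h.1, h'⟩
  · have := Set.ext_iff.1 hX.1.inter_eq t
    simpa [ht] using this

lemma IsSteinerHypercactus.exists_corresponds (hS : IsSteinerHypercactus G T H φ)
    {T' A X : Set V} (hT' : T' ⊆ T) (hX : G.IsCutOf T' A X) (hm : G.IsSteinerMincut T X) :
    ∃ Q, Corresponds T H φ X Q := by
  have hAX : A ⊆ X ∩ T := fun a ha => ⟨hX.2.2.1 ha, hT' (hX.2.1.1 ha)⟩
  have hcut : G.IsCutOf T (X ∩ T) X := by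
    obtain ⟨s, hs, hsX⟩ := hm.1.2
    refine ⟨hX.1.mono hAX, ⟨Set.inter_subset_right, fun h => hsX (h hs).1⟩, Set.inter_subset_left,
      Set.disjoint_left.2 fun s hs hsX => hs.2 ⟨hsX, hs.1⟩, fun y hy => ?_⟩
    obtain ⟨a, ha, hr⟩ := hX.2.2.2.2 y hy
    exact ⟨a, hAX ha, hr⟩
  obtain ⟨Q, hQ, hsep⟩ :=
    (hS.mincut_iff _ X ⟨hcut, fun Y hY => hm.2 Y hY.steinerCut⟩).1 hm
  refine ⟨Q, hQ, hsep.1, ?_⟩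
  convert hsep.2 using 2
  ext t
  simp only [Set.mem_sdiff, Set.mem_inter_iff]
  tauto

/-- A cut isolating one terminal that is a Steiner mincut does not halve a hyperedge: otherwise the
part of it in one branch of `e` could be cut off by a Steiner mincut with the same boundary. -/
theorem not_halves_of_isCutOf [Finite V] [Finite E] [Finite W] [Finite F]
    (hS : IsSteinerHypercactus G T H φ) {e : F} (he : 3 ≤ H.rank e)
    (hne : NonemptyBranches T H φ e) {T' : Set V} (hT' : T' ⊆ T) {t : V} {X : Set V}
    (hX : G.IsCutOf T' {t} X) (hm : G.IsSteinerMincut T X) {Q : Set W}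
    (hQ : Corresponds T H φ X Q) : ¬ H.Halves Q e := by
  intro hh
  have hH := hS.isHypercactus
  have htT : t ∈ T := hT' (hX.2.1.1 rfl)
  have htX : t ∈ X := hX.2.2.1 rfl
  have hb := hQ.1.boundary_eq hH he hh.mem_boundary
  obtain ⟨i₀, hi₀, hr₀⟩ := hH.exists_reach (inc_nonempty_of_rank he) (φ t)
  have hi₀Q : i₀ ∈ Q := (hr₀.mem_iff_of_boundary_eq hb).2 ((hQ.mem_iff htT).2 htX)
  obtain ⟨i, ⟨hi, hiQ⟩, hii₀⟩ := hh.1.exists_ne i₀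
  obtain ⟨j, ⟨hj, hjQ⟩, l, ⟨hl, hlQ⟩, hjl⟩ := hh.2
  have hij : i ≠ j := fun h => hjQ (h ▸ hiQ)
  have hil : i ≠ l := fun h => hlQ (h ▸ hiQ)
  have hi₀j : i₀ ≠ j := fun h => hjQ (h ▸ hi₀Q)
  have hi₀l : i₀ ≠ l := fun h => hlQ (h ▸ hi₀Q)
  obtain ⟨ti, hti, hri⟩ := hne i hi
  obtain ⟨tj, htj, hrj⟩ := hne j hj
  obtain ⟨tl, htl, hrl⟩ := hne l hl
  have hX_i : ti ∈ X := (hQ.mem_iff hti).1 ((hri.mem_iff_of_boundary_eq hb).1 hiQ)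
  have hX_j : tj ∉ X := fun h => hjQ ((hrj.mem_iff_of_boundary_eq hb).2 ((hQ.mem_iff htj).2 h))
  have hX_l : tl ∉ X := fun h => hlQ ((hrl.mem_iff_of_boundary_eq hb).2 ((hQ.mem_iff htl).2 h))
  have real : ∀ m ∈ H.inc e, m ≠ i → m ≠ i₀ → ∃ Z, G.IsSteinerMincut T Z ∧
      ∀ s ∈ T, ∀ n ∈ H.inc e, H.Reach {e}ᶜ n (φ s) → (s ∈ Z ↔ n = i ∨ n = m) := by
    intro m hme hmi hmi₀
    have hI : ({i, m} : Set W) ⊆ H.inc e := by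
      rintro n (rfl | rfl) <;> assumption
    have hI' : ({i, m} : Set W) ⊂ H.inc e := ⟨hI, fun h => by
      rcases h hi₀ with h | h
      · exact hii₀ h.symm
      · exact hmi₀ h.symm⟩
    have hR := hQ.1.of_boundary_eq hb (hH.boundary_branches he hI' ⟨i, Or.inl rfl⟩)
    obtain ⟨Z, hZ, hZmem⟩ := hS.exists_isSteinerMincut hR ⟨ti, hti, i, Or.inl rfl, hri⟩
      ⟨t, htT, fun h => by
        rcases (hH.mem_branches_iff he hI hi₀ hr₀).1 h with h | h
        · exact hii₀ h.symm
        · exact hmi₀ h.symm⟩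
    refine ⟨Z, hZ, fun s hs n hn hns => ?_⟩
    rw [hZmem s hs, hH.mem_branches_iff he hI hn hns]
    rfl
  obtain ⟨Z, hZ, hZmem⟩ := real j hj hij.symm hi₀j.symm
  obtain ⟨Y, hY, hYmem⟩ := real l hl hil.symm hi₀l.symm
  have htZ : t ∉ Z := by rw [hZmem t htT i₀ hi₀ hr₀]; tauto
  have htiZ : ti ∈ Z := by rw [hZmem ti hti i hi hri]; tauto
  have hZX : G.boundary Z = G.boundary X := by
    refine (boundary_eq_of_four_terminals hm hZ hY ⟨ti, hti, hX_i, htiZ, ?_⟩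
      ⟨t, htT, htX, htZ, ?_⟩ ⟨tj, htj, hX_j, ?_, ?_⟩ ⟨tl, htl, hX_l, ?_, ?_⟩).1
    · rw [hYmem ti hti i hi hri]; tauto
    · rw [hYmem t htT i₀ hi₀ hr₀]; tauto
    · rw [hZmem tj htj j hj hrj]; tauto
    · rw [hYmem tj htj j hj hrj]; tauto
    · rw [hZmem tl htl l hl hrl]; tauto
    · rw [hYmem tl htl l hl hrl]; tauto
  obtain ⟨a, rfl, hr⟩ := hX.2.2.2.2 ti hX_i
  exact htZ (hr.mem (S := Z) (fun f hf => by rwa [hZX]) htiZ)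

/-- A cut found by the sampling loop is an isolating cut of a set of terminals, and it is a Steiner
mincut of the whole terminal set. -/
lemma exists_of_mem_foundCuts {𝒯 : Set (Set V)} (h𝒯 : ∀ T' ∈ 𝒯, T' ⊆ T) {X : Set V}
    (hX : X ∈ G.foundCuts T 𝒯) :
    ∃ T' ⊆ T, ∃ t ∈ T', G.IsMaxMincutOf T' {t} X ∧ G.IsSteinerMincut T X := by
  obtain ⟨T', hT', t, ht, hXm, hval⟩ := hX
  obtain ⟨⟨a, ha, haX⟩, ⟨b, hb, hbX⟩⟩ := hXm.1.1.steinerCut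
  exact ⟨T', h𝒯 T' hT', t, ht, hXm, ⟨⟨a, h𝒯 T' hT' ha, haX⟩, ⟨b, h𝒯 T' hT' hb, hbX⟩⟩,
    fun Y hY => hval ▸ steinerValue_le hY⟩

/-! ### The selected splits -/

/-- Removing other found cuts, none of which is contained in `X`, from a found cut `X` leaves a set
that does not halve a hyperedge. -/
theorem not_halves_diff [Finite V] [Finite E] [Finite W] [Finite F]
    (hS : IsSteinerHypercactus G T H φ) {e : F} (he : 3 ≤ H.rank e)
    (hne : NonemptyBranches T H φ e) {𝒯 : Set (Set V)} (h𝒯 : ∀ T' ∈ 𝒯, T' ⊆ T) {X : Set V}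
    (hX : X ∈ G.foundCuts T 𝒯) {U : Set V}
    (hU : ∀ y ∈ U, ∃ Y ∈ G.foundCuts T 𝒯, y ∈ Y ∧ Y ⊆ U ∧ ¬ Y ⊆ X) {Q : Set W}
    (hQ : Corresponds T H φ (X \ U) Q) : ¬ H.Halves Q e := by
  intro hh
  have hH := hS.isHypercactus
  have hb := hQ.1.boundary_eq hH he hh.mem_boundary
  obtain ⟨y, ⟨hy, hyQ⟩, z, ⟨hz, hzQ⟩, hyz⟩ := hh.1
  obtain ⟨ty, hty, hry⟩ := hne y hy
  obtain ⟨tz, htz, hrz⟩ := hne z hz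
  have hyX := (hQ.mem_iff hty).1 ((hry.mem_iff_of_boundary_eq hb).1 hyQ)
  have hzX := (hQ.mem_iff htz).1 ((hrz.mem_iff_of_boundary_eq hb).1 hzQ)
  obtain ⟨T', hT', t, ht, hXmax, hXm⟩ := exists_of_mem_foundCuts h𝒯 hX
  obtain ⟨P, hP⟩ := hS.exists_corresponds hT' hXmax.1.1 hXm
  obtain ⟨k, hk, hPk⟩ := hP.1.compl_subset_branch hH he
    (not_halves_of_isCutOf hS he hne hT' hXmax.1.1 hXm hP) hy hz hyz hry hrz
    ((hP.mem_iff hty).2 hyX.1) ((hP.mem_iff htz).2 hzX.1)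
  -- a branch outside `Q`, all of whose terminals lie in `X`, hence in the removed set
  obtain ⟨j, ⟨hj, hjQ⟩, hjk⟩ := hh.2.exists_ne k
  have hjX : ∀ s ∈ T, H.Reach {e}ᶜ j (φ s) → s ∈ X := by
    intro s hs hr
    by_contra hsX
    exact hjk ((hH.mem_branches_iff he (Set.singleton_subset_iff.2 hk) hj hr).1
      (hPk fun h => hsX ((hP.mem_iff hs).1 h)))
  obtain ⟨s, hs, hrs⟩ := hne j hj
  have hsU : s ∈ U := by
    by_contra hsU
    exact hjQ ((hrs.mem_iff_of_boundary_eq hb).2 ((hQ.mem_iff hs).2 ⟨hjX s hs hrs, hsU⟩))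
  obtain ⟨Y, hY, hsY, hYU, hYX⟩ := hU s hsU
  obtain ⟨T'', hT'', r, hr, hYmax, hYm⟩ := exists_of_mem_foundCuts h𝒯 hY
  obtain ⟨R, hR⟩ := hS.exists_corresponds hT'' hYmax.1.1 hYm
  have hRh := not_halves_of_isCutOf hS he hne hT'' hYmax.1.1 hYm hR
  obtain ⟨l, hl, hRl⟩ := hR.1.compl.compl_subset_branch hH he
    (fun h => hRh (compl_compl R ▸ h.compl)) hy hz hyz hry hrz
    (fun h => hyX.2 (hYU ((hR.mem_iff hty).1 h))) (fun h => hzX.2 (hYU ((hR.mem_iff htz).1 h)))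
  rw [compl_compl] at hRl
  have hls : ({l} : Set W) ⊆ H.inc e := Set.singleton_subset_iff.2 hl
  have hjl : j = l := (hH.mem_branches_iff he hls hj hrs).1 (hRl ((hR.mem_iff hs).2 hsY))
  refine hYX (hXmax.subset_of_inter_subset hT' hXm (Set.singleton_subset_iff.2 (hT'' hr))
    hYmax.1.1 hYm fun p hp => ?_)
  obtain ⟨_, rfl, hlp⟩ := hRl ((hR.mem_iff hp.1).2 hp.2)
  exact hjX p hp.1 (hjl ▸ hlp)

lemma maximalMembers_subset {T : Set V} {𝒮₀ : Set (Set V)} :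
    maximalMembers (smallCuts T 𝒮₀) ⊆ 𝒮₀ := fun _ h => h.1.1

/-- No selected split halves a hyperedge. -/
lemma SplitCollection.not_halves [Finite V] [Finite E] [Finite W] [Finite F]
    (hS : IsSteinerHypercactus G T H φ) {e : F} (he : 3 ≤ H.rank e)
    (hne : NonemptyBranches T H φ e) {𝒯 : Set (Set V)} (h𝒯 : ∀ T' ∈ 𝒯, T' ⊆ T)
    {𝒮 : Set (Set V)} (h𝒮 : SplitCollection T (G.foundCuts T 𝒯) 𝒮) {X : Set V}
    (hX : X ∈ G.foundCuts T 𝒯 ∪ 𝒮) {Q : Set W} (hQ : Corresponds T H φ X Q) :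
    ¬ H.Halves Q e := by
  have found : ∀ X ∈ G.foundCuts T 𝒯, Corresponds T H φ X Q → ¬ H.Halves Q e := by
    intro X hX hQ
    obtain ⟨T', hT', t, ht, hmax, hm⟩ := exists_of_mem_foundCuts h𝒯 hX
    exact not_halves_of_isCutOf hS he hne hT' hmax.1.1 hm hQ
  rcases hX with hX | hX
  · exact found X hX hQ
  cases h𝒮 with
  | balanced Y hY _ => exact found X (by rwa [Set.mem_singleton_iff.1 hX]) hQ
  | unbalanced _ k Y inj hY =>
    obtain ⟨i, rfl⟩ := hX
    have hmem : ∀ i, Y i ∈ maximalMembers (smallCuts T (G.foundCuts T 𝒯)) := fun i =>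
      hY ▸ Set.mem_range_self i
    refine not_halves_diff hS he hne h𝒯 (maximalMembers_subset (hmem i)) (fun y hy => ?_) hQ
    simp only [Set.mem_iUnion] at hy
    obtain ⟨j, hji, hyj⟩ := hy
    refine ⟨Y j, maximalMembers_subset (hmem j), hyj, fun z hz => ?_,
      (hmem j).2 _ (hmem i).1 fun h => hji.ne' (inj h)⟩
    simp only [Set.mem_iUnion]
    exact ⟨j, hji, hz⟩

lemma SplitCollection.pairwiseDisjoint {𝒮₀ 𝒮 : Set (Set V)} (h𝒮 : SplitCollection T 𝒮₀ 𝒮)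
    {X Y : Set V} (hX : X ∈ 𝒮) (hY : Y ∈ 𝒮) (hXY : X ≠ Y) : Disjoint X Y := by
  cases h𝒮 with
  | balanced Z hZ _ => exact absurd (hX.trans hY.symm) hXY
  | unbalanced _ k Z inj hZ =>
    obtain ⟨i, rfl⟩ := hX
    obtain ⟨j, rfl⟩ := hY
    rw [Set.disjoint_left]
    rintro y ⟨h1, h2⟩ ⟨h3, h4⟩
    simp only [Set.mem_iUnion, not_exists] at h2 h4
    rcases lt_trichotomy i j with h | rfl | h
    · exact h4 i h h1
    · exact hXY rfl
    · exact h2 j h h3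

/-! ### Decompositions -/

lemma contractedRank_le_two [Finite W] {𝒞 : Set (Set W)} {S : Set W} (hS : S ∈ 𝒞) {e : F}
    (h : (H.inc e \ S).Subsingleton) : H.contractedRank 𝒞 e ≤ 2 := by
  have h1 : (toContracted 𝒞 '' S).ncard ≤ 1 := by
    rw [Set.ncard_le_one]
    rintro _ ⟨y, hy, rfl⟩ _ ⟨z, hz, rfl⟩
    exact Quot.sound ⟨S, hS, hy, hz⟩
  have h2 : (toContracted 𝒞 '' (H.inc e \ S)).ncard ≤ 1 := by
    rw [Set.ncard_le_one]
    exact fun a ha b hb => h.image _ ha hb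
  have hsub : toContracted 𝒞 '' H.inc e ⊆
      toContracted 𝒞 '' S ∪ toContracted 𝒞 '' (H.inc e \ S) := by
    rw [← Set.image_union, Set.union_sdiff_self]
    exact Set.image_mono Set.subset_union_right
  calc H.contractedRank 𝒞 e ≤ _ := Set.ncard_le_ncard hsub (Set.toFinite _)
    _ ≤ _ := Set.ncard_union_le _ _
    _ ≤ 2 := by omega

/-- If no cut of the family halves `e`, a nontrivial decomposition of `e` must come from two cuts
that both contain at least two nodes of `e`: contracting one such cut leaves rank at most `2`. -/
lemma Decomposes.exists_ne [Finite W] {𝒬 : Set (Set W)} {e : F} (h : H.Decomposes 𝒬 e)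
    (hh : ∀ Q ∈ 𝒬, ¬ H.Halves Q e) : ∃ Q ∈ 𝒬, ∃ R ∈ 𝒬, Q ≠ R ∧
      (H.inc e ∩ Q).Nontrivial ∧ (H.inc e ∩ R).Nontrivial := by
  have hsome : ∀ Q : ↥𝒬, 3 ≤ H.partRank 𝒬 e (some Q) → (H.inc e ∩ Q).Nontrivial := by
    intro Q hQ
    by_contra hn
    have := contractedRank_le_two (H := H) (S := (Q : Set W)ᶜ) (𝒞 := {(Q : Set W)ᶜ}) rfl (e := e)
      (by rw [Set.sdiff_compl]; exact Set.not_nontrivial_iff.1 hn)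
    exact absurd (hQ.trans this) (by norm_num)
  have hnone : ∀ Q : ↥𝒬, 3 ≤ H.partRank 𝒬 e (some Q) → ¬ 3 ≤ H.partRank 𝒬 e none := by
    intro Q hQ hN
    have hs : (H.inc e \ Q).Subsingleton :=
      Set.not_nontrivial_iff.1 fun h => hh Q Q.2 ⟨hsome Q hQ, h⟩
    exact absurd (hN.trans (contractedRank_le_two Q.2 hs)) (by norm_num)
  obtain ⟨i, j, hij, hi, hj⟩ := h
  match i, j with
  | none, none => exact absurd rfl hij
  | some Q, none => exact absurd hj (hnone Q hi)
  | none, some Q => exact absurd hi (hnone Q hj)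
  | some Q, some R =>
    exact ⟨Q, Q.2, R, R.2, fun h => hij (congrArg some (Subtype.ext h)), hsome Q hi, hsome R hj⟩

/-- Two cuts that both contain at least two nodes of `e`, and do not halve `e`, have a common
terminal: both contain all branches but one, and there are at least three branches. -/
lemma exists_mem_of_nontrivial [Finite W] [Finite F] (hS : IsSteinerHypercactus G T H φ) {e : F}
    (he : 3 ≤ H.rank e) (hne : NonemptyBranches T H φ e) {X Y : Set V} {Q R : Set W}
    (hX : Corresponds T H φ X Q) (hY : Corresponds T H φ Y R) (hQ : ¬ H.Halves Q e)
    (hR : ¬ H.Halves R e) (hQn : (H.inc e ∩ Q).Nontrivial) (hRn : (H.inc e ∩ R).Nontrivial) :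
    ∃ t, t ∈ X ∧ t ∈ Y := by
  have hH := hS.isHypercactus
  have key : ∀ {Q : Set W}, H.IsGlobalMincut Q → ¬ H.Halves Q e → (H.inc e ∩ Q).Nontrivial →
      ∃ k ∈ H.inc e, Qᶜ ⊆ H.branches e {k} := by
    rintro Q hm hQ ⟨y, ⟨hy, hyQ⟩, z, ⟨hz, hzQ⟩, hyz⟩
    exact hm.compl_subset_branch hH he hQ hy hz hyz Relation.ReflTransGen.refl
      Relation.ReflTransGen.refl hyQ hzQ
  obtain ⟨k, hk, hQk⟩ := key hX.1 hQ hQn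
  obtain ⟨l, hl, hRl⟩ := key hY.1 hR hRn
  obtain ⟨m, hm, hmkl⟩ : ∃ m ∈ H.inc e, m ∉ ({k, l} : Set W) := by
    refine Set.exists_mem_notMem_of_ncard_lt_ncard ?_
    have := Set.ncard_insert_le k {l}
    rw [Set.ncard_singleton] at this
    unfold rank at he
    omega
  simp only [Set.mem_insert_iff, Set.mem_singleton_iff, not_or] at hmkl
  obtain ⟨t, ht, hr⟩ := hne m hm
  refine ⟨t, (hX.mem_iff ht).1 ?_, (hY.mem_iff ht).1 ?_⟩
  · by_contra h
    exact hmkl.1 ((hH.mem_branches_iff he (Set.singleton_subset_iff.2 hk) hm hr).1 (hQk h))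
  · by_contra h
    exact hmkl.2 ((hH.mem_branches_iff he (Set.singleton_subset_iff.2 hl) hm hr).1 (hRl h))

end Steiner

section Brittle

/-! ### Terminal sets all of whose bipartitions are induced by Steiner mincuts -/

variable {V : Type u} {E : Type v} {G : WHypergraph V E} {T : Set V}

/-- If all mincuts of nonempty proper subsets of `T` are Steiner mincuts, every bipartition of `T`
is induced by a Steiner mincut. -/
lemma exists_isSteinerMincut_inter_eq [Finite V]
    (hall : ∀ A, A.Nonempty → A ⊂ T → ∀ X, G.IsMincutOf T A X → G.IsSteinerMincut T X)
    (p : V → Prop) (h1 : ∃ t ∈ T, p t) (h2 : ∃ t ∈ T, ¬ p t) :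
    ∃ X, G.IsSteinerMincut T X ∧ ∀ t ∈ T, t ∈ X ↔ p t := by
  obtain ⟨t, ht, hpt⟩ := h1
  obtain ⟨s, hs, hps⟩ := h2
  have hne : {t | t ∈ T ∧ p t}.Nonempty := ⟨t, ht, hpt⟩
  have hss : {t | t ∈ T ∧ p t} ⊂ T := ⟨fun t h => h.1, fun h => hps (h hs).2⟩
  obtain ⟨X, hX⟩ := exists_isMincutOf (G := G) hne hss
  refine ⟨X, hall _ hne hss X hX, fun t ht => ?_⟩
  have := Set.ext_iff.1 hX.1.inter_eq t
  simpa [ht] using this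

lemma boundary_eq_of_crossing [Finite V] [Finite E]
    (hall : ∀ A, A.Nonempty → A ⊂ T → ∀ X, G.IsMincutOf T A X → G.IsSteinerMincut T X)
    {X Y : Set V} (hX : G.IsSteinerMincut T X) (hY : G.IsSteinerMincut T Y)
    (h1 : ∃ t ∈ T, t ∈ X ∧ t ∈ Y) (h2 : ∃ t ∈ T, t ∈ X ∧ t ∉ Y)
    (h3 : ∃ t ∈ T, t ∉ X ∧ t ∈ Y) (h4 : ∃ t ∈ T, t ∉ X ∧ t ∉ Y) :
    G.boundary Y = G.boundary X := by
  obtain ⟨t1, m1, a1, b1⟩ := h1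
  obtain ⟨t2, m2, a2, b2⟩ := h2
  obtain ⟨t3, m3, a3, b3⟩ := h3
  obtain ⟨t4, m4, a4, b4⟩ := h4
  obtain ⟨Z, hZ, hZm⟩ := exists_isSteinerMincut_inter_eq hall (fun t => t ∈ X ↔ t ∈ Y)
    ⟨t1, m1, by tauto⟩ ⟨t2, m2, by tauto⟩
  exact (boundary_eq_of_four_terminals hX hY hZ ⟨t1, m1, a1, b1, (hZm t1 m1).2 (by tauto)⟩
    ⟨t2, m2, a2, b2, fun h => by have := (hZm t2 m2).1 h; tauto⟩
    ⟨t3, m3, a3, b3, fun h => by have := (hZm t3 m3).1 h; tauto⟩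
    ⟨t4, m4, a4, b4, (hZm t4 m4).2 (by tauto)⟩).1

/-- All Steiner mincuts with at least two terminals on both sides have the same boundary: if two of
them do not cross, there is a third one that crosses both. -/
lemma boundary_eq_of_nontrivial [Finite V] [Finite E]
    (hall : ∀ A, A.Nonempty → A ⊂ T → ∀ X, G.IsMincutOf T A X → G.IsSteinerMincut T X)
    {X Y : Set V} (hX : G.IsSteinerMincut T X) (hY : G.IsSteinerMincut T Y)
    (hX1 : (T ∩ X).Nontrivial) (hX2 : (T \ X).Nontrivial) (hY1 : (T ∩ Y).Nontrivial)
    (hY2 : (T \ Y).Nontrivial) : G.boundary X = G.boundary Y := by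
  -- enough: terminals `p, q` and `r, s` such that each cut has `p, q` on one side, `r, s` on the
  -- other; a cut that separates `p, r` from `q, s` then crosses both
  have pairs : ∀ p q r s, p ∈ T → q ∈ T → r ∈ T → s ∈ T → p ≠ q → r ≠ s →
      (p ∈ X ↔ q ∈ X) → (r ∈ X ↔ s ∈ X) → ¬ (p ∈ X ↔ r ∈ X) →
      (p ∈ Y ↔ q ∈ Y) → (r ∈ Y ↔ s ∈ Y) → ¬ (p ∈ Y ↔ r ∈ Y) →
      G.boundary X = G.boundary Y := by
    intro p q r s hp hq hr hs hpq hrs h1 h2 h3 h4 h5 h6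
    have hpr : p ≠ r := by rintro rfl; exact h3 Iff.rfl
    have hps : p ≠ s := by rintro rfl; exact h3 h2.symm
    have hqr : q ≠ r := by rintro rfl; exact h3 h1
    obtain ⟨Z, hZ, hZm⟩ := exists_isSteinerMincut_inter_eq hall (fun t => t = p ∨ t = r)
      ⟨p, hp, Or.inl rfl⟩ ⟨q, hq, not_or.2 ⟨hpq.symm, hqr⟩⟩
    have zp : p ∈ Z := (hZm p hp).2 (Or.inl rfl)
    have zq : q ∉ Z := fun h => ((hZm q hq).1 h).elim hpq.symm hqr
    have zr : r ∈ Z := (hZm r hr).2 (Or.inr rfl)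
    have zs : s ∉ Z := fun h => ((hZm s hs).1 h).elim hps.symm hrs.symm
    have cross : ∀ {Y : Set V}, G.IsSteinerMincut T Y → (p ∈ Y ↔ q ∈ Y) → (r ∈ Y ↔ s ∈ Y) →
        ¬ (p ∈ Y ↔ r ∈ Y) → G.boundary Z = G.boundary Y := by
      intro Y hY k1 k2 k3
      by_cases hpY : p ∈ Y
      · have hrY : r ∉ Y := fun h => k3 (iff_of_true hpY h)
        exact boundary_eq_of_crossing hall hY hZ ⟨p, hp, hpY, zp⟩ ⟨q, hq, k1.1 hpY, zq⟩
          ⟨r, hr, hrY, zr⟩ ⟨s, hs, mt k2.2 hrY, zs⟩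
      · have hrY : r ∈ Y := not_not.1 fun h => k3 (iff_of_false hpY h)
        exact boundary_eq_of_crossing hall hY hZ ⟨r, hr, hrY, zr⟩ ⟨s, hs, k2.1 hrY, zs⟩
          ⟨p, hp, hpY, zp⟩ ⟨q, hq, mt k1.2 hpY, zq⟩
    rw [← cross hX h1 h2 h3, ← cross hY h4 h5 h6]
  obtain ⟨a, ⟨ha, haX⟩, a', ⟨ha', haX'⟩, haa⟩ := hX1
  obtain ⟨b, ⟨hb, hbX⟩, b', ⟨hb', hbX'⟩, hbb⟩ := hX2
  obtain ⟨c, ⟨hc, hcY⟩, c', ⟨hc', hcY'⟩, hcc⟩ := hY1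
  obtain ⟨d, ⟨hd, hdY⟩, d', ⟨hd', hdY'⟩, hdd⟩ := hY2
  by_cases h1 : ∃ t ∈ T, t ∈ X ∧ t ∈ Y
  · by_cases h2 : ∃ t ∈ T, t ∈ X ∧ t ∉ Y
    · by_cases h3 : ∃ t ∈ T, t ∉ X ∧ t ∈ Y
      · by_cases h4 : ∃ t ∈ T, t ∉ X ∧ t ∉ Y
        · exact (boundary_eq_of_crossing hall hX hY h1 h2 h3 h4).symm
        · push Not at h4
          have hX' : ∀ t ∈ T, t ∉ Y → t ∈ X := fun t ht h => not_not.1 fun hX => h (h4 t ht hX)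
          exact pairs b b' d d' hb hb' hd hd' hbb hdd (iff_of_false hbX hbX')
            (iff_of_true (hX' d hd hdY) (hX' d' hd' hdY')) (fun h => hbX (h.2 (hX' d hd hdY)))
            (iff_of_true (h4 b hb hbX) (h4 b' hb' hbX')) (iff_of_false hdY hdY')
            (fun h => hdY (h.1 (h4 b hb hbX)))
      · push Not at h3
        have hX' : ∀ t ∈ T, t ∈ Y → t ∈ X := fun t ht h => not_not.1 fun hX => h3 t ht hX h
        exact pairs c c' b b' hc hc' hb hb' hcc hbb
          (iff_of_true (hX' c hc hcY) (hX' c' hc' hcY')) (iff_of_false hbX hbX')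
          (fun h => hbX (h.1 (hX' c hc hcY))) (iff_of_true hcY hcY')
          (iff_of_false (h3 b hb hbX) (h3 b' hb' hbX')) (fun h => h3 b hb hbX (h.1 hcY))
    · push Not at h2
      have hX' : ∀ t ∈ T, t ∉ Y → t ∉ X := fun t ht h hX => h (h2 t ht hX)
      exact pairs a a' d d' ha ha' hd hd' haa hdd (iff_of_true haX haX')
        (iff_of_false (hX' d hd hdY) (hX' d' hd' hdY')) (fun h => hX' d hd hdY (h.1 haX))
        (iff_of_true (h2 a ha haX) (h2 a' ha' haX')) (iff_of_false hdY hdY')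
        (fun h => hdY (h.1 (h2 a ha haX)))
  · push Not at h1
    have hX' : ∀ t ∈ T, t ∈ Y → t ∉ X := fun t ht h hX => h1 t ht hX h
    exact pairs a a' c c' ha ha' hc hc' haa hcc (iff_of_true haX haX')
      (iff_of_false (hX' c hc hcY) (hX' c' hc' hcY')) (fun h => hX' c hc hcY (h.1 haX))
      (iff_of_false (h1 a ha haX) (h1 a' ha' haX')) (iff_of_true hcY hcY')
      (fun h => h1 a ha haX (h.2 hcY))

/-- The boundary of a maximal `{a}`-mincut is that of some Steiner mincut with at least two
terminals on both sides. -/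
lemma exists_boundary_eq_of_isMaxMincutOf_singleton [Finite V] [Finite E]
    (hall : ∀ A, A.Nonempty → A ⊂ T → ∀ X, G.IsMincutOf T A X → G.IsSteinerMincut T X)
    (hT : 4 ≤ T.ncard) {a : V} {X : Set V} (hX : G.IsMaxMincutOf T {a} X) :
    ∃ Y, G.IsSteinerMincut T Y ∧ (T ∩ Y).Nontrivial ∧ (T \ Y).Nontrivial ∧
      G.boundary X = G.boundary Y := by
  have haT : a ∈ T := hX.1.1.2.1.1 rfl
  have haX : a ∈ X := hX.1.1.2.2.1 rfl
  have hXT : ∀ t ∈ T, t ∈ X → t = a := fun t ht htX => hX.1.1.inter_eq.subset ⟨ht, htX⟩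
  have hXm := hall _ hX.1.1.1 hX.1.1.2.1 X hX.1
  obtain ⟨b, c, d, hb, hc, hd, hbc, hbd, hcd⟩ := (Set.two_lt_ncard_iff (s := T \ {a})).1 (by
    have := Set.ncard_sdiff_singleton_add_one haT
    omega)
  simp only [Set.mem_sdiff, Set.mem_singleton_iff] at hb hc hd
  have real : ∀ p : V → Prop, p a → (∃ t ∈ T, ¬ p t) →
      ∃ Y, G.IsSteinerMincut T Y ∧ X ⊆ Y ∧ ∀ t ∈ T, t ∈ Y ↔ p t := by
    rintro p hpa ⟨s, hs, hps⟩
    obtain ⟨Y, hY, hYm⟩ := exists_isSteinerMincut_inter_eq hall p ⟨a, haT, hpa⟩ ⟨s, hs, hps⟩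
    refine ⟨X ∪ Y, hXm.union hY ⟨a, haT, haX, (hYm a haT).2 hpa⟩
      ⟨s, hs, fun h => hps (hXT s hs h ▸ hpa), fun h => hps ((hYm s hs).1 h)⟩,
      Set.subset_union_left, fun t ht => ?_⟩
    rw [Set.mem_union, hYm t ht]
    refine ⟨?_, Or.inr⟩
    rintro (h | h)
    · rwa [hXT t ht h]
    · exact h
  obtain ⟨P, hP, hXP, hPm⟩ := real (fun t => t = a ∨ t = b) (Or.inl rfl) ⟨c, hc.1, by tauto⟩
  obtain ⟨Q, hQ, hXQ, hQm⟩ := real (fun t => t = a ∨ t = c) (Or.inl rfl) ⟨b, hb.1, by tauto⟩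
  obtain ⟨R, hR, hXR, hRm⟩ := real (fun t => t ≠ b ∧ t ≠ c) ⟨Ne.symm hb.2, Ne.symm hc.2⟩
    ⟨b, hb.1, by tauto⟩
  have hmem : ∀ t ∈ T, (t ∈ P ↔ t = a ∨ t = b) ∧ (t ∈ Q ↔ t = a ∨ t = c) ∧
      (t ∈ R ↔ t ≠ b ∧ t ≠ c) := fun t ht => ⟨hPm t ht, hQm t ht, hRm t ht⟩
  have ma := hmem a haT
  have mb := hmem b hb.1
  have mc := hmem c hc.1
  have md := hmem d hd.1
  have hbound := (boundary_eq_of_four_terminals hP hQ hR ⟨a, haT, by grind⟩ ⟨b, hb.1, by grind⟩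
    ⟨c, hc.1, by grind⟩ ⟨d, hd.1, by grind⟩).2
  refine ⟨P, hP, ⟨a, ⟨haT, by grind⟩, b, ⟨hb.1, by grind⟩, Ne.symm hb.2⟩,
    ⟨c, ⟨hc.1, by grind⟩, d, ⟨hd.1, by grind⟩, hcd⟩, ?_⟩
  have hXS : X ⊆ P ∩ Q ∩ R := fun y hy => ⟨⟨hXP hy, hXQ hy⟩, hXR hy⟩
  obtain ⟨hcut, hsub⟩ := isCutOf_reachable (G := G) (S := P ∩ Q ∩ R) (Set.singleton_nonempty a)
    hX.1.1.2.1 (Set.singleton_subset_iff.2 (hXS haX)) (Set.disjoint_left.2 (by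
      rintro t ⟨ht, hta⟩ ⟨⟨h1, h2⟩, -⟩
      have := hmem t ht
      simp only [Set.mem_singleton_iff] at hta
      grind))
  have hmin : G.IsMincutOf T {a} {y | y ∈ P ∩ Q ∩ R ∧
      ∃ b ∈ ({a} : Set V), G.Reach (G.boundary (P ∩ Q ∩ R))ᶜ y b} := by
    refine ⟨hcut, fun Y hY => (cutValue_mono (Y := P) (hbound ▸ hsub)).trans ?_⟩
    exact hP.2 Y hY.steinerCut
  have heq : {y | y ∈ P ∩ Q ∩ R ∧
      ∃ b ∈ ({a} : Set V), G.Reach (G.boundary (P ∩ Q ∩ R))ᶜ y b} = X := by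
    refine (hX.2 _ hmin).antisymm fun y hy => ⟨hXS hy, ?_⟩
    obtain ⟨b, hb, hr⟩ := hX.1.1.2.2.2.2 y hy
    exact ⟨b, hb, hr.of_subset hXS hy⟩
  rw [heq, hbound] at hsub
  exact boundary_eq_of_subset hsub (hP.cutValue_eq hXm).le

/-- If all mincuts of nonempty proper subsets of `T` are Steiner mincuts, all maximal mincuts of
sets that leave at least two terminals outside have one common boundary. -/
theorem existsUnique_boundary [Finite V] [Finite E] (hT : 4 ≤ T.ncard)
    (hall : ∀ A, A.Nonempty → A ⊂ T → ∀ X, G.IsMincutOf T A X → G.IsSteinerMincut T X) :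
    ∃! D : Set E, ∀ A : Set V, A.Nonempty → A ⊆ T → A.ncard ≤ T.ncard - 2 →
      ∀ X : Set V, G.IsMaxMincutOf T A X → G.boundary X = D := by
  obtain ⟨a, ha⟩ : T.Nonempty := Set.nonempty_of_ncard_ne_zero (by omega)
  have hsing : ({a} : Set V) ⊂ T := by
    refine Set.ssubset_iff_subset_ne.2 ⟨Set.singleton_subset_iff.2 ha, fun h => ?_⟩
    rw [← h, Set.ncard_singleton] at hT
    omega
  obtain ⟨X₀, hX₀⟩ := exists_isMaxMincutOf (Set.singleton_nonempty a) hsing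
    (hall _ (Set.singleton_nonempty a) hsing)
  obtain ⟨Y₀, hY₀, h1, h2, hb⟩ := exists_boundary_eq_of_isMaxMincutOf_singleton hall hT hX₀
  refine ⟨G.boundary X₀, fun A hA hAT hcard X hX => ?_, fun D hD => ?_⟩
  · rw [hb]
    by_cases hn : A.Nontrivial
    · refine boundary_eq_of_nontrivial hall (hall A hA hX.1.1.2.1 X hX.1) hY₀ ?_ ?_ h1 h2
      · rwa [hX.1.1.inter_eq]
      · rw [← Set.sdiff_self_inter, hX.1.1.inter_eq, ← Set.one_lt_ncard_iff_nontrivial]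
        have := Set.ncard_sdiff_add_ncard_of_subset hAT
        omega
    · obtain ⟨b, rfl⟩ := Set.exists_eq_singleton_iff_nonempty_subsingleton.2
        ⟨hA, Set.not_nontrivial_iff.1 hn⟩
      obtain ⟨Y, hY, h3, h4, hb'⟩ := exists_boundary_eq_of_isMaxMincutOf_singleton hall hT hX
      rw [hb']
      exact boundary_eq_of_nontrivial hall hY hY₀ h3 h4 h1 h2
  · refine (hD {a} (Set.singleton_nonempty a) hsing.1 ?_ X₀ hX₀).symm
    rw [Set.ncard_singleton]
    omega

/-- In a brittle all nonempty proper sets of nodes are global mincuts, so if the terminals are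
distinct nodes, all mincuts of nonempty proper subsets of `T` are Steiner mincuts. -/
lemma IsSteinerHypercactus.isSteinerMincut_of_isBrittle {W : Type w} {F : Type x}
    {H : WHypergraph W F} {φ : V → W} (hS : IsSteinerHypercactus G T H φ) (hB : H.IsBrittle)
    (hφ : Set.InjOn φ T) {A : Set V} (hA : A.Nonempty) (hAT : A ⊂ T) {X : Set V}
    (hX : G.IsMincutOf T A X) : G.IsSteinerMincut T X := by
  obtain ⟨e, heu, hef⟩ := hB
  have hb : ∀ Q : Set W, Q.Nonempty → Q ≠ Set.univ → H.boundary Q = {e} := by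
    rintro Q ⟨y, hy⟩ hQ
    obtain ⟨z, hz⟩ := (Set.ne_univ_iff_exists_notMem Q).1 hQ
    ext f
    rw [hef f]
    refine iff_of_true ⟨⟨y, ?_, hy⟩, ⟨z, ?_, hz⟩⟩ rfl <;> rw [heu] <;> trivial
  have hsep : Separates (φ '' A) (φ '' A) (φ '' (T \ A)) := by
    refine ⟨subset_rfl, Set.disjoint_left.2 ?_⟩
    rintro _ ⟨s, hs, rfl⟩ ⟨a, ha, h⟩
    exact hs.2 (hφ (hAT.1 ha) hs.1 h ▸ ha)
  obtain ⟨s, hs, hsA⟩ := Set.exists_of_ssubset hAT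
  have hne : φ '' A ≠ Set.univ := fun h =>
    Set.disjoint_left.1 hsep.2 ⟨s, ⟨hs, hsA⟩, rfl⟩ (h ▸ Set.mem_univ _)
  refine (hS.mincut_iff A X hX).2 ⟨φ '' A, ⟨hA.image φ, hne, fun R hR hR' => ?_⟩, hsep⟩
  rw [cutValue_of_boundary_eq (hb _ (hA.image φ) hne), cutValue_of_boundary_eq (hb R hR hR')]

end Brittle

end WHypergraph

theorem lemma5p1 {V : Type u} {E : Type v} [Finite V] [Finite E]
    (G : WHypergraph V E) (T : Set V) :
    -- (1) a maximal isolating mincut that is a Steiner mincut meets `e` trivially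
    (∀ (W : Type w) (F : Type x) [Finite W] [Finite F] (H : WHypergraph W F) (φ : V → W),
      WHypergraph.IsSteinerHypercactus G T H φ →
      ∀ e : F, 3 ≤ H.rank e → WHypergraph.NonemptyBranches T H φ e →
      ∀ T' ⊆ T, 2 ≤ T'.ncard → ∀ t ∈ T', ∀ X : Set V,
        G.IsMaxIsolatingMincut T' t X → G.IsSteinerMincut T' X →
        ∀ Q : Set W, WHypergraph.Corresponds T H φ X Q →
          (Q ∩ H.inc e).ncard = 0 ∨ (Q ∩ H.inc e).ncard = 1 ∨
          (Q ∩ H.inc e).ncard = H.rank e - 1 ∨ (Q ∩ H.inc e).ncard = H.rank e) ∧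
    -- (2) no call of the algorithm finds splits that decompose `e` nontrivially
    (∀ J : WHypergraph.Problem.{u, v}, WHypergraph.Problem.Calls ⟨V, E, G, T⟩ J →
      ∀ (W : Type w) (F : Type x) [Finite W] [Finite F] (H : WHypergraph W F) (φ : J.V → W),
      WHypergraph.IsSteinerHypercactus J.G J.T H φ →
      ∀ e : F, 3 ≤ H.rank e → WHypergraph.NonemptyBranches J.T H φ e →
      ∀ 𝒮₀ 𝒮 : Set (Set J.V), J.Divides 𝒮₀ 𝒮 →
        (∀ X ∈ 𝒮₀ ∪ 𝒮, ∀ Q : Set W, WHypergraph.Corresponds J.T H φ X Q →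
          ¬ H.Decomposes {Q} e) ∧
        (∀ q : Set J.V → Set W, (∀ X ∈ 𝒮, WHypergraph.Corresponds J.T H φ X (q X)) →
          ¬ H.Decomposes (q '' 𝒮) e)) ∧
    -- (3) in the brittle case all these maximal mincuts have the same boundary
    (∀ (W : Type w) (F : Type x) [Finite W] [Finite F] (H : WHypergraph W F) (φ : V → W),
      WHypergraph.IsSteinerHypercactus G T H φ → H.IsBrittle → Set.InjOn φ T → 4 ≤ T.ncard →
      ∃! D : Set E, ∀ A : Set V, A.Nonempty → A ⊆ T → A.ncard ≤ T.ncard - 2 →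
        ∀ X : Set V, G.IsMaxMincutOf T A X → G.boundary X = D) := by
  refine ⟨?_, ?_, ?_⟩
  · intro W F _ _ H φ hS e he hne T' hT' _ t _ X hX hXm Q hQ
    obtain ⟨⟨a, ha, haX⟩, ⟨b, hb, hbX⟩⟩ := hXm.1
    -- the cut realising `Q` is a Steiner cut of `T'` too, so `T` and `T'` have the same value
    obtain ⟨Y, hY, hYmem⟩ := hS.exists_isSteinerMincut hQ.1
      ⟨a, hT' ha, (hQ.mem_iff (hT' ha)).2 haX⟩ ⟨b, hT' hb, fun h => hbX ((hQ.mem_iff (hT' hb)).1 h)⟩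
    have hYcut : WHypergraph.IsSteinerCut T' Y := by
      refine ⟨⟨a, ha, ?_⟩, ⟨b, hb, ?_⟩⟩
      · rw [hYmem a (hT' ha), hQ.mem_iff (hT' ha)]
        exact haX
      · rw [hYmem b (hT' hb), hQ.mem_iff (hT' hb)]
        exact hbX
    have hXT : G.IsSteinerMincut T X := ⟨⟨⟨a, hT' ha, haX⟩, ⟨b, hT' hb, hbX⟩⟩, fun R hR =>
      (hXm.2 Y hYcut).trans (hY.2 R hR)⟩
    have hh := WHypergraph.not_halves_of_isCutOf hS he hne hT' hX.1.1 hXT hQ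
    have hcard := Set.ncard_inter_add_ncard_sdiff_eq_ncard (H.inc e) Q (Set.toFinite _)
    unfold WHypergraph.Halves at hh
    rw [← Set.one_lt_ncard_iff_nontrivial, ← Set.one_lt_ncard_iff_nontrivial] at hh
    rw [Set.inter_comm Q]
    unfold WHypergraph.rank at he ⊢
    omega
  · intro J _ W F _ _ H φ hS e he hne 𝒮₀ 𝒮 hdiv
    obtain ⟨-, 𝒯, h𝒯, rfl, hsplit⟩ := hdiv
    have hh : ∀ X ∈ J.G.foundCuts J.T 𝒯 ∪ 𝒮, ∀ Q, WHypergraph.Corresponds J.T H φ X Q →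
        ¬ H.Halves Q e := fun X hX Q hQ => hsplit.not_halves hS he hne h𝒯 hX hQ
    refine ⟨fun X hX Q hQ hdec => ?_, fun q hq hdec => ?_⟩
    · obtain ⟨R, rfl, S, rfl, hne', -⟩ := hdec.exists_ne (by rintro R rfl; exact hh X hX R hQ)
      exact hne' rfl
    · have hhq : ∀ X ∈ 𝒮, ¬ H.Halves (q X) e := fun X hX => hh X (Or.inr hX) _ (hq X hX)
      obtain ⟨_, ⟨X, hX, rfl⟩, _, ⟨Y, hY, rfl⟩, hXY, h1, h2⟩ :=
        hdec.exists_ne (by rintro _ ⟨X, hX, rfl⟩; exact hhq X hX)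
      obtain ⟨t, htX, htY⟩ := WHypergraph.exists_mem_of_nontrivial hS he hne (hq X hX) (hq Y hY)
        (hhq X hX) (hhq Y hY) h1 h2
      exact Set.disjoint_left.1 (hsplit.pairwiseDisjoint hX hY fun h => hXY (h ▸ rfl)) htX htY
  · intro W F _ _ H φ hS hB hφ hT
    exact WHypergraph.existsUnique_boundary hT fun A hA hAT X hX =>
      hS.isSteinerMincut_of_isBrittle hB hφ hA hAT hX
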